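/- Let $m, n_1,\dots,n_m$ be positive integers, $1<p<q<\infty$, $0<\beta_i<n_i$ and $\frac1q=\frac1p-\frac{\beta_i}{n_i}$ for $1\le i\le m$. For a real- or complex-valued $f\in L^p(\mathbb{R}^{n_1}\times\cdots\times\mathbb{R}^{n_m})$ put $$\mathscr{H}_{\beta_1,\dots,\beta_m}(f)(x)=\prod_{i=1}^m\frac{1}{|B(0,|x_i|)|^{1-\beta_i/n_i}}\int_{|y_1|<|x_1|}\cdots\int_{|y_m|<|x_m|}f(y_1,\dots,y_m)\,dy_1\cdots dy_m$$ for $x=(x_1,\dots,x_m)$ with all $x_i\ne0$, where $|B(0,r)|$ is the Lebesgue measure of the open Euclidean ball of radius $r$ in $\mathbb{R}^{n_i}$. Then $f$ is integrable on each of these products of balls, $\mathscr{H}_{\beta_1,\dots,\beta_m}(f)\in L^q(\mathbb{R}^{n_1}\times\cdots\times\mathbb{R}^{n_m})$ and $$\|\mathscr{H}_{\beta_1,\dots,\beta_m}(f)\|_{L^q}\le C\,\|f\|_{L^p},\qquad C=\prod_{i=1}^m\left(\frac{p'}{q}\right)^{1/q}\left(\frac{n_i}{q\beta_i}\,B\!\left(\frac{n_i}{q\beta_i},\frac{n_i}{q'\beta_i}\right)\right)^{-\beta_i/n_i},$$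 where $\frac1p+\frac1{p'}=\frac1q+\frac1{q'}=1$ and $B(z,w)=\int_0^1t^{z-1}(1-t)^{w-1}\,dt$. Moreover, the operator norm is exactly $$\|\mathscr{H}_{\beta_1,\dots,\beta_m}\|_{L^p\to L^q}=C,$$ and the supremum of $\|\mathscr{H}_{\beta_1,\dots,\beta_m}(f)\|_{L^q}/\|f\|_{L^p}$ over the non-negative $f\in L^p$ with $\|f\|_{L^p}\ne0$ is also $C$. -/

import Mathlib

open MeasureTheory
open scoped ENNReal

/-- The product space `ℝ^{n₁} × ⋯ × ℝ^{n_m}`; each factor carries the Euclidean norm and the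
product carries the product Lebesgue measure. -/
abbrev ProdSpace {m : ℕ} (n : Fin m → ℕ) : Type :=
  (i : Fin m) → EuclideanSpace ℝ (Fin (n i))

/-- The product of open balls `B(0,|x₁|) × ⋯ × B(0,|x_m|)`. -/
def polyBall {m : ℕ} {n : Fin m → ℕ} (x : ProdSpace n) : Set (ProdSpace n) :=
  Set.univ.pi fun i => Metric.ball (0 : EuclideanSpace ℝ (Fin (n i))) ‖x i‖

/-- The fractional Hardy type operator `ℋ_{β₁,…,β_m}`, on scalar-valued functions. -/
noncomputable def hardyOp {𝕜 : Type*} [RCLike 𝕜] {m : ℕ} {n : Fin m → ℕ} (β : Fin m → ℝ)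
    (f : ProdSpace n → 𝕜) (x : ProdSpace n) : 𝕜 :=
  (∏ i, 1 / (volume.real (Metric.ball (0 : EuclideanSpace ℝ (Fin (n i))) ‖x i‖)) ^
      (1 - β i / (n i : ℝ))) • ∫ y in polyBall x, f y

/-- The Euler beta function `B(z,w) = ∫₀¹ t^{z-1} (1-t)^{w-1} dt` for real `z, w > 0`. -/
noncomputable def eulerBeta (z w : ℝ) : ℝ :=
  ∫ t in (0 : ℝ)..1, t ^ (z - 1) * (1 - t) ^ (w - 1)

/-- The constant `∏ᵢ (p'/q)^{1/q} ((nᵢ/(qβᵢ)) B(nᵢ/(qβᵢ), nᵢ/(q'βᵢ)))^{-βᵢ/nᵢ}`. -/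
noncomputable def hardyConst {m : ℕ} (n : Fin m → ℕ) (β : Fin m → ℝ) (p q : ℝ) : ℝ :=
  ∏ i, (p.conjExponent / q) ^ (1 / q) *
    ((n i : ℝ) / (q * β i) *
      eulerBeta ((n i : ℝ) / (q * β i)) ((n i : ℝ) / (q.conjExponent * β i))) ^ (-(β i / (n i : ℝ)))

/-! Every β_i/n_i equals 1/p - 1/q, so with r = q/p - 1 = qβ_i/n_i and p = q/(r+1) a single exponent
governs all factors. The operator is a tensor product of positive integral operators with kernels
`hardyKernel`. Since p ≤ q, Minkowski's inequality with exponent q/p makes the bounds on the factors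
multiply (`lintegral_prod_kernel_le`). On one factor the ball volume V = `ballVol` carries Lebesgue
measure to Lebesgue measure on (0,∞) (`map_ballVol`), and the bound becomes Bliss' inequality for
F(t) = ∫_{V<t} f, namely ∫ F^q t^{r-q} dt ≤ C^q (∫ f^p)^{q/p} (`bliss_lintegral_le`), where C is the
constant of one factor.

Bliss' inequality is proved by monotone transport. Let I = ∫ (1+y^r)^{-q/r} dy (`blissMass`) and
w(y) = y^r (1+y^r)^{-q/r}, which has mass I/(q-r-1). After scaling, F^q t^{r-q} has this mass too;
let T transport it to w. The AM-GM inequality bounds T'(1+T^r)^{1-q/r} by F^{q-r}(-φ')/(q-r-1),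
where φ is a product of powers of x and T (`exists_bliss_weight`). Integration by parts and Hölder's
inequality then give I ≤ N^{1/p} I^{1/p'} with N = ∫ f^p, that is I ≤ N (`blissMass_le_lintegral`).
Homogeneity and truncation give the general case.

For f = (1+V^r)^{-(r+1)/r} the two densities coincide and equality holds. The tensor product of
these functions is non-negative and attains the constant, so the operator norm and the supremum over
non-negative functions agree. -/

section

open Set Filter Topology

/-! ### Mixed norms and tensor products of positive operators. -/

/-- Minkowski's integral inequality for non-negative functions. -/
theorem lintegral_rpow_lintegral_le {X Y : Type*} [MeasurableSpace X] [MeasurableSpace Y]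
    {μ : Measure X} {ν : Measure Y} [SigmaFinite μ] [SFinite ν] {h : X → Y → ℝ≥0∞}
    (hh : Measurable (Function.uncurry h)) {s : ℝ} (hs : 1 ≤ s) :
    ∫⁻ x, (∫⁻ y, h x y ∂ν) ^ s ∂μ ≤ (∫⁻ y, (∫⁻ x, h x y ^ s ∂μ) ^ (1 / s) ∂ν) ^ s := by
  rcases hs.eq_or_lt with rfl | hs1
  · simp only [ENNReal.rpow_one, div_one]
    exact (lintegral_lintegral_swap hh.aemeasurable).le
  have hs0 : 0 < s := by linarith
  by_contra! hlt
  set A := ∫⁻ y, (∫⁻ x, h x y ^ s ∂μ) ^ (1 / s) ∂ν with hA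
  -- If the inequality fails, some simple minorant g already violates it; its integral J is finite,
  -- so powers of J can be cancelled.
  obtain ⟨g, hg, hgfin, hgA⟩ : ∃ g : SimpleFunc X NNReal,
      (∀ x, (g x : ℝ≥0∞) ≤ (∫⁻ y, h x y ∂ν) ^ s) ∧ ∫⁻ x, g x ∂μ < ∞ ∧ A ^ s < ∫⁻ x, g x ∂μ := by
    simp_rw [lintegral_eq_nnreal (μ := μ), lt_iSup_iff] at hlt
    obtain ⟨g₀, hg₀, hlt⟩ := hlt
    obtain ⟨g, hg, h1, h2⟩ := SimpleFunc.exists_lt_lintegral_simpleFunc_of_lt_lintegral (f := g₀)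
      (μ := μ) (hlt.trans_eq (by rw [← SimpleFunc.lintegral_eq_lintegral]; rfl))
    exact ⟨g, fun x => (ENNReal.coe_le_coe.2 (hg x)).trans (hg₀ x), h1, h2⟩
  have hgm : Measurable fun x => (g x : ℝ≥0∞) := g.measurable.coe_nnreal_ennreal
  set J := ∫⁻ x, (g x : ℝ≥0∞) ∂μ with hJ
  have hconj : s.HolderConjugate (s / (s - 1)) := Real.HolderConjugate.conjExponent hs1
  set s' := s / (s - 1) with hs'
  have hs'0 : 0 < s' := hconj.symm.pos
  -- Duality: g = g^{1/s} g^{1/s'}, whose first factor is at most ∫ h dν; then Tonelli, and Hölder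
  -- in x.
  have key : J ≤ A * J ^ (1 / s') := by
    calc J ≤ ∫⁻ x, (∫⁻ y, h x y ∂ν) * (g x : ℝ≥0∞) ^ (1 / s') ∂μ := by
          refine lintegral_mono fun x => ?_
          have h1 : (g x : ℝ≥0∞) ^ (1 / s) ≤ ∫⁻ y, h x y ∂ν := by
            rw [one_div, ENNReal.rpow_inv_le_iff hs0]; exact hg x
          calc (g x : ℝ≥0∞) = (g x : ℝ≥0∞) ^ (1 / s) * (g x : ℝ≥0∞) ^ (1 / s') := by
                rw [← ENNReal.rpow_add_of_nonneg _ _ (by positivity) (by positivity), one_div,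
                  one_div, hconj.inv_add_inv_eq_one, ENNReal.rpow_one]
            _ ≤ _ := by gcongr
      _ = ∫⁻ y, ∫⁻ x, h x y * (g x : ℝ≥0∞) ^ (1 / s') ∂μ ∂ν := by
          rw [← lintegral_lintegral_swap]
          · refine lintegral_congr fun x => ?_
            rw [lintegral_mul_const _ (hh.of_uncurry_left)]
          · exact (hh.mul ((hgm.comp measurable_fst).pow_const _)).aemeasurable
      _ ≤ ∫⁻ y, (∫⁻ x, h x y ^ s ∂μ) ^ (1 / s) * J ^ (1 / s') ∂ν := by
          refine lintegral_mono fun y => ?_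
          refine (ENNReal.lintegral_mul_le_Lp_mul_Lq μ hconj (f := fun x => h x y)
            (g := fun x => (g x : ℝ≥0∞) ^ (1 / s')) hh.of_uncurry_right.aemeasurable
            (hgm.pow_const _).aemeasurable).trans (le_of_eq ?_)
          simp_rw [← ENNReal.rpow_mul, one_div_mul_cancel hs'0.ne', ENNReal.rpow_one]
          rfl
      _ = A * J ^ (1 / s') := by
          rw [lintegral_mul_const]
          exact (Measurable.lintegral_prod_left (hh.pow_const s)).pow_const _
  have hJ0 : J ≠ 0 := (lt_of_le_of_lt zero_le hgA).ne'
  have hJt : J ≠ ∞ := hgfin.ne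
  have h2 : J ^ (1 / s) ≤ A := by
    have h3 : J = J ^ (1 / s) * J ^ (1 / s') := by
      rw [← ENNReal.rpow_add_of_nonneg _ _ (by positivity) (by positivity), one_div,
        one_div, hconj.inv_add_inv_eq_one, ENNReal.rpow_one]
    have h4 : J ^ (1 / s') ≠ 0 := by simp [hJ0, hJt]
    have h5 : J ^ (1 / s') ≠ ∞ := by simp [hJ0, hJt]
    rw [h3] at key
    refine (ENNReal.mul_le_mul_iff_left h4 h5).1 ?_
    rwa [← h3] at key ⊢
  rw [one_div, ENNReal.rpow_inv_le_iff hs0] at h2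
  exact absurd hgA (not_lt.2 h2)

/-- A finite product splits off its first factor, as a measure space. -/
theorem exists_measurableEquiv_pi_fin_succ {m : ℕ} {E : Fin (m + 1) → Type*}
    [∀ i, MeasurableSpace (E i)] (μ : ∀ i, Measure (E i)) [∀ i, SigmaFinite (μ i)] :
    ∃ e : (E 0 × ∀ i : Fin m, E i.succ) ≃ᵐ ∀ i, E i,
      (∀ z, e z 0 = z.1) ∧ (∀ z (i : Fin m), e z i.succ = z.2 i) ∧
      MeasurePreserving e ((μ 0).prod (Measure.pi fun i => μ i.succ)) (Measure.pi μ) :=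
  ⟨(MeasurableEquiv.piFinSuccAbove E 0).symm, fun _ => rfl, fun _ _ => rfl,
    (measurePreserving_piFinSuccAbove μ 0).symm⟩

/-- `L^p → L^q` bounds, `p ≤ q`, for integral operators with non-negative kernels are
multiplicative under tensor products. -/
theorem lintegral_prod_kernel_le {m : ℕ} {E : Fin m → Type*} [∀ i, MeasurableSpace (E i)]
    (μ : ∀ i, Measure (E i)) [∀ i, SigmaFinite (μ i)] (K : ∀ i, E i → E i → ℝ≥0∞)
    (hK : ∀ i, Measurable (Function.uncurry (K i))) {p q : ℝ} (hp : 0 < p) (hpq : p ≤ q)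
    (D : Fin m → ℝ≥0∞)
    (hD : ∀ i (g : E i → ℝ≥0∞), Measurable g →
      ∫⁻ x, (∫⁻ y, K i x y * g y ∂μ i) ^ q ∂μ i ≤ D i * (∫⁻ y, g y ^ p ∂μ i) ^ (q / p))
    (f : (∀ i, E i) → ℝ≥0∞) (hf : Measurable f) :
    ∫⁻ x, (∫⁻ y, (∏ i, K i (x i) (y i)) * f y ∂Measure.pi μ) ^ q ∂Measure.pi μ ≤
      (∏ i, D i) * (∫⁻ y, f y ^ p ∂Measure.pi μ) ^ (q / p) := by
  have hq : 0 < q := hp.trans_le hpq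
  induction m with
  | zero =>
    simp only [Finset.univ_eq_empty, Finset.prod_empty, one_mul]
    rw [Measure.pi_of_empty _ isEmptyElim]
    simp [lintegral_dirac' _ hf, lintegral_dirac' _ (hf.pow_const p), ← ENNReal.rpow_mul,
      mul_div_cancel₀ _ hp.ne']
  | succ m ih =>
    let ν : Measure (∀ i : Fin m, E i.succ) := Measure.pi fun i => μ i.succ
    let K' : (∀ i : Fin m, E i.succ) → (∀ i : Fin m, E i.succ) → ℝ≥0∞ :=
      fun x y => ∏ i, K i.succ (x i) (y i)
    have hK' : Measurable (Function.uncurry K') := by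
      refine Finset.measurable_prod _ fun i _ => ?_
      have h1 : Measurable fun z : (∀ i : Fin m, E i.succ) × (∀ i : Fin m, E i.succ) =>
          (z.1 i, z.2 i) := by fun_prop
      exact (hK i.succ).comp h1
    obtain ⟨e, e0, es, mp⟩ := exists_measurableEquiv_pi_fin_succ μ
    have tr : ∀ F : (∀ i, E i) → ℝ≥0∞, ∫⁻ x, F x ∂Measure.pi μ =
        ∫⁻ z : E 0 × (∀ i : Fin m, E i.succ), F (e z) ∂((μ 0).prod ν) := by
      intro F
      exact (mp.lintegral_comp_emb e.measurableEmbedding F).symm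
    let f' : E 0 → (∀ i : Fin m, E i.succ) → ℝ≥0∞ := fun a b => f (e (a, b))
    have hf' : Measurable (Function.uncurry f') := hf.comp e.measurable
    -- The operator of the remaining coordinates, applied to each slice of `f`; the full operator is
    -- the zeroth one applied to `H x`.
    let H : (∀ i : Fin m, E i.succ) → E 0 → ℝ≥0∞ := fun x a => ∫⁻ b, K' x b * f' a b ∂ν
    have hH : Measurable (Function.uncurry H) := by
      refine Measurable.lintegral_prod_right
        (f := fun (z : (∀ i : Fin m, E i.succ) × E 0) (b : ∀ i : Fin m, E i.succ) =>
          K' z.1 b * f' z.2 b) ?_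
      exact (hK'.comp ((measurable_fst.comp measurable_fst).prodMk measurable_snd)).mul
        (hf'.comp ((measurable_snd.comp measurable_fst).prodMk measurable_snd))
    have inner : ∀ z : E 0 × (∀ i : Fin m, E i.succ),
        ∫⁻ y, (∏ i, K i (e z i) (y i)) * f y ∂Measure.pi μ =
          ∫⁻ a, K 0 z.1 a * H z.2 a ∂μ 0 := by
      intro z
      rw [tr, lintegral_prod]
      · refine lintegral_congr fun a => ?_
        rw [← lintegral_const_mul]
        · refine lintegral_congr fun b => ?_
          simp only [Fin.prod_univ_succ, e0, es, K', f', mul_assoc]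
        · exact (hK'.comp (measurable_const.prodMk measurable_id)).mul
            (hf'.comp (measurable_const.prodMk measurable_id))
      · refine Measurable.aemeasurable (Measurable.mul ?_ (hf.comp e.measurable))
        refine Finset.measurable_prod _ fun i _ => ?_
        exact (hK i).comp (measurable_const.prodMk
          ((measurable_pi_apply i).comp e.measurable))
    rw [tr]
    simp_rw [inner]
    have hqp : 1 ≤ q / p := (one_le_div hp).2 hpq
    rw [lintegral_prod_symm']
    swap
    · refine Measurable.pow_const ?_ _
      refine Measurable.lintegral_prod_right
        (f := fun (z : E 0 × (∀ i : Fin m, E i.succ)) (b : E 0) => K 0 z.1 b * H z.2 b) ?_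
      exact ((hK 0).comp ((measurable_fst.comp measurable_fst).prodMk measurable_snd)).mul
        (hH.comp ((measurable_snd.comp measurable_fst).prodMk measurable_snd))
    calc ∫⁻ x, ∫⁻ a, (∫⁻ b, K 0 a b * H x b ∂μ 0) ^ q ∂μ 0 ∂ν
        ≤ ∫⁻ x, D 0 * (∫⁻ b, H x b ^ p ∂μ 0) ^ (q / p) ∂ν :=
          lintegral_mono fun x => hD 0 _ hH.of_uncurry_left
      _ = D 0 * ∫⁻ x, (∫⁻ b, H x b ^ p ∂μ 0) ^ (q / p) ∂ν :=
          lintegral_const_mul _ ((Measurable.lintegral_prod_right (hH.pow_const p)).pow_const _)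
      -- Minkowski moves the L^q norm in x inside the L^p norm in b, where the induction hypothesis
      -- applies to slices; this uses q/p ≥ 1.
      _ ≤ D 0 * (∫⁻ b, (∫⁻ x, (H x b ^ p) ^ (q / p) ∂ν) ^ (1 / (q / p)) ∂μ 0) ^ (q / p) := by
          gcongr
          exact lintegral_rpow_lintegral_le (hH.pow_const p) hqp
      _ ≤ D 0 * (∫⁻ b, (∏ i : Fin m, D i.succ) ^ (p / q) *
            ∫⁻ y, f' b y ^ p ∂ν ∂μ 0) ^ (q / p) := by
          gcongr with b
          simp_rw [← ENNReal.rpow_mul, mul_div_cancel₀ _ hp.ne']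
          refine (ENNReal.rpow_le_rpow (ih (fun i => μ i.succ) (fun i => K i.succ)
            (fun i => hK i.succ) (fun i => D i.succ) (fun i => hD i.succ) (f' b)
            hf'.of_uncurry_left) (by positivity)).trans (le_of_eq ?_)
          rw [ENNReal.mul_rpow_of_nonneg _ _ (by positivity), ← ENNReal.rpow_mul,
            mul_one_div_cancel (by positivity), ENNReal.rpow_one, one_div_div]
      _ = (∏ i, D i) * (∫⁻ y, f y ^ p ∂Measure.pi μ) ^ (q / p) := by
          rw [lintegral_const_mul _ (Measurable.lintegral_prod_right (hf'.pow_const p)),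
            ENNReal.mul_rpow_of_nonneg _ _ (by positivity), ← ENNReal.rpow_mul,
            div_mul_div_cancel₀ hq.ne', div_self hp.ne', ENNReal.rpow_one, Fin.prod_univ_succ,
            mul_assoc, tr, lintegral_prod (fun z => f (e z) ^ p)
              ((hf.comp e.measurable).pow_const p).aemeasurable]

/-- Tonelli's theorem for products of functions of one coordinate each. -/
theorem lintegral_pi_prod_eq {m : ℕ} {E : Fin m → Type*} [∀ i, MeasurableSpace (E i)]
    (μ : ∀ i, Measure (E i)) [∀ i, SigmaFinite (μ i)] (f : ∀ i, E i → ℝ≥0∞)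
    (hf : ∀ i, Measurable (f i)) :
    ∫⁻ x, ∏ i, f i (x i) ∂Measure.pi μ = ∏ i, ∫⁻ x, f i x ∂μ i := by
  induction m with
  | zero => simp
  | succ m ih =>
    obtain ⟨e, e0, es, mp⟩ := exists_measurableEquiv_pi_fin_succ μ
    rw [← mp.lintegral_comp_emb e.measurableEmbedding, Fin.prod_univ_succ]
    have hm : Measurable fun y : (∀ i : Fin m, E i.succ) => ∏ i, f i.succ (y i) :=
      Finset.measurable_prod _ fun i _ => (hf _).comp (measurable_pi_apply i)
    rw [← ih (fun i => μ i.succ) (fun i => f i.succ) (fun i => hf _),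
      ← lintegral_prod_mul (hf 0).aemeasurable hm.aemeasurable]
    refine lintegral_congr fun z => ?_
    simp only [Fin.prod_univ_succ, e0, es]

/-! ### The extremal profile and its integrals. -/

section Profile

lemma one_add_rpow_pos {y : ℝ} (hy : 0 ≤ y) (r : ℝ) : 0 < 1 + y ^ r := by positivity

lemma continuousOn_one_add_rpow_rpow {r : ℝ} (hr : 0 < r) (e : ℝ) :
    ContinuousOn (fun y : ℝ => (1 + y ^ r) ^ e) (Ici 0) := by
  intro y hy
  refine ContinuousAt.continuousWithinAt ?_
  refine ContinuousAt.rpow_const ?_ (Or.inl (one_add_rpow_pos hy r).ne')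
  exact continuousAt_const.add (Real.continuousAt_rpow_const _ _ (Or.inr hr.le))

lemma integrableOn_one_add_rpow_rpow {r e : ℝ} (hr : 0 < r) (he : 1 < r * e) :
    IntegrableOn (fun y : ℝ => (1 + y ^ r) ^ (-e)) (Ioi 0) := by
  have he0 : 0 < e := by
    by_contra! h
    nlinarith [mul_nonneg hr.le (neg_nonneg.2 h)]
  rw [← Ioc_union_Ioi_eq_Ioi zero_le_one, integrableOn_union]
  constructor
  · exact ((continuousOn_one_add_rpow_rpow hr (-e)).mono Icc_subset_Ici_self).integrableOn_Icc
      |>.mono_set Ioc_subset_Icc_self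
  · refine Integrable.mono' (integrableOn_Ioi_rpow_of_lt (a := -(r * e)) (by linarith) one_pos)
      ?_ ?_
    · exact ((continuousOn_one_add_rpow_rpow hr (-e)).mono
        (Ioi_subset_Ici zero_le_one)).aestronglyMeasurable measurableSet_Ioi
    · filter_upwards [ae_restrict_mem measurableSet_Ioi] with y hy
      have hy0 : (0 : ℝ) < y := zero_lt_one.trans hy
      rw [Real.norm_of_nonneg (by positivity), ← mul_neg, Real.rpow_mul hy0.le]
      exact Real.rpow_le_rpow_of_nonpos (by positivity) (by linarith) (by linarith)

/-- The `L^p` mass `∫₀^∞ (1+y^r)^{-q/r} dy` of the extremal function of Bliss' inequality. -/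
noncomputable def blissMass (q r : ℝ) : ℝ := ∫ y in Ioi (0 : ℝ), (1 + y ^ r) ^ (-(q / r))

variable {q r : ℝ}

lemma integrableOn_blissMass (hr : 0 < r) (hq : r + 1 < q) :
    IntegrableOn (fun y : ℝ => (1 + y ^ r) ^ (-(q / r))) (Ioi 0) :=
  integrableOn_one_add_rpow_rpow hr (by rw [mul_div_cancel₀ _ hr.ne']; linarith)

lemma integrableOn_one_add_rpow_one_sub (hr : 0 < r) (hq : r + 1 < q) :
    IntegrableOn (fun y : ℝ => (1 + y ^ r) ^ (1 - q / r)) (Ioi 0) := by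
  have := integrableOn_one_add_rpow_rpow (e := q / r - 1) hr
    (by rw [mul_sub, mul_div_cancel₀ _ hr.ne']; linarith)
  simpa using this

lemma rpow_mul_one_add_rpow_eq {y : ℝ} (hy : 0 < y) :
    y ^ r * (1 + y ^ r) ^ (-(q / r)) =
      (1 + y ^ r) ^ (1 - q / r) - (1 + y ^ r) ^ (-(q / r)) := by
  rw [sub_eq_add_neg (1 : ℝ), Real.rpow_add (one_add_rpow_pos hy.le r), Real.rpow_one]
  ring

lemma integrableOn_rpow_mul_one_add_rpow (hr : 0 < r) (hq : r + 1 < q) :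
    IntegrableOn (fun y : ℝ => y ^ r * (1 + y ^ r) ^ (-(q / r))) (Ioi 0) :=
  ((integrableOn_one_add_rpow_one_sub hr hq).sub (integrableOn_blissMass hr hq)).congr_fun
    (fun _ hy => (rpow_mul_one_add_rpow_eq hy).symm) measurableSet_Ioi

lemma blissMass_pos (hr : 0 < r) (hq : r + 1 < q) : 0 < blissMass q r := by
  refine (setIntegral_pos_iff_support_of_nonneg_ae ?_ (integrableOn_blissMass hr hq)).2 ?_
  · filter_upwards [ae_restrict_mem measurableSet_Ioi] with y hy
    exact (Real.rpow_pos_of_pos (one_add_rpow_pos (le_of_lt hy) r) _).le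
  · refine lt_of_lt_of_le ?_ (measure_mono (s := Ioi 0) fun y hy =>
      ⟨(Real.rpow_pos_of_pos (one_add_rpow_pos (le_of_lt hy) r) _).ne', hy⟩)
    simp

/-- The function y(1+y^r)^{1-q/r} vanishes at 0 and at ∞, and its derivative is the combination
(1+y^r)^{-q/r} - (q-r-1) y^r (1+y^r)^{-q/r}. -/
lemma integral_rpow_mul_one_add_rpow (hr : 0 < r) (hq : r + 1 < q) :
    ∫ y in Ioi (0 : ℝ), y ^ r * (1 + y ^ r) ^ (-(q / r)) = blissMass q r / (q - r - 1) := by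
  have hd : ∀ y ∈ Ioi (0 : ℝ), HasDerivAt (fun y : ℝ => y * (1 + y ^ r) ^ (1 - q / r))
      ((1 + y ^ r) ^ (-(q / r)) - (q - r - 1) * (y ^ r * (1 + y ^ r) ^ (-(q / r)))) y := by
    intro y hy
    have hy0 : (0 : ℝ) < y := hy
    have hP := one_add_rpow_pos hy0.le r
    have h1 : HasDerivAt (fun y : ℝ => 1 + y ^ r) (r * y ^ (r - 1)) y :=
      (Real.hasDerivAt_rpow_const (Or.inl hy0.ne')).const_add 1
    have h2 := (hasDerivAt_id y).mul (h1.rpow_const (p := 1 - q / r) (Or.inl hP.ne'))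
    refine h2.congr_deriv ?_
    rw [show 1 - q / r - 1 = -(q / r) by ring, show 1 - q / r = 1 + -(q / r) by ring,
      Real.rpow_add hP, Real.rpow_one, Real.rpow_sub_one hy0.ne']
    simp only [id]
    field_simp
    ring
  have hint : IntegrableOn (fun y : ℝ => (1 + y ^ r) ^ (-(q / r)) -
      (q - r - 1) * (y ^ r * (1 + y ^ r) ^ (-(q / r)))) (Ioi 0) :=
    (integrableOn_blissMass hr hq).sub ((integrableOn_rpow_mul_one_add_rpow hr hq).const_mul _)
  have hcont : ContinuousWithinAt (fun y : ℝ => y * (1 + y ^ r) ^ (1 - q / r)) (Ici 0) 0 :=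
    continuousWithinAt_id.mul (continuousOn_one_add_rpow_rpow hr _ 0 self_mem_Ici)
  have hlim : Tendsto (fun y : ℝ => y * (1 + y ^ r) ^ (1 - q / r)) atTop (𝓝 0) := by
    have h0 : Tendsto (fun y : ℝ => y ^ (-(q - r - 1))) atTop (𝓝 0) :=
      tendsto_rpow_neg_atTop (by linarith)
    refine tendsto_of_tendsto_of_tendsto_of_le_of_le' tendsto_const_nhds h0 ?_ ?_
    · filter_upwards [eventually_gt_atTop 0] with y hy
      have := one_add_rpow_pos hy.le r
      positivity
    · filter_upwards [eventually_gt_atTop 0] with y hy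
      calc y * (1 + y ^ r) ^ (1 - q / r) ≤ y * (y ^ r) ^ (1 - q / r) := by
            gcongr ?_ * ?_
            refine Real.rpow_le_rpow_of_nonpos (by positivity) (by linarith) ?_
            rw [sub_nonpos, one_le_div hr]; linarith
        _ = y ^ (-(q - r - 1)) := by
            rw [← Real.rpow_mul hy.le, ← Real.rpow_one_add' hy.le]
            · congr 1; field_simp; ring
            · field_simp; linarith
  have h := integral_Ioi_of_hasDerivAt_of_tendsto hcont hd hint hlim
  rw [integral_sub (integrableOn_blissMass hr hq)
    ((integrableOn_rpow_mul_one_add_rpow hr hq).const_mul _), integral_const_mul] at h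
  rw [eq_div_iff (by linarith), blissMass]
  simp only [zero_mul, sub_zero] at h
  linarith

lemma integral_one_add_rpow_one_sub (hr : 0 < r) (hq : r + 1 < q) :
    ∫ y in Ioi (0 : ℝ), (1 + y ^ r) ^ (1 - q / r) =
      blissMass q r * ((q - r) / (q - r - 1)) := by
  have h := integral_rpow_mul_one_add_rpow hr hq
  rw [setIntegral_congr_fun measurableSet_Ioi fun y hy => rpow_mul_one_add_rpow_eq hy,
    integral_sub (integrableOn_one_add_rpow_one_sub hr hq) (integrableOn_blissMass hr hq),
    ← blissMass] at h
  have : q - r - 1 ≠ 0 := by linarith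
  rw [sub_eq_iff_eq_add.1 h]
  field_simp
  ring

/-- The mass of the extremal function is a value of the Euler beta function. -/
lemma blissMass_eq_eulerBeta (hr : 0 < r) :
    blissMass q r = 1 / r * eulerBeta (1 / r) ((q - 1) / r) := by
  -- Substitution y = (t/(1-t))^{1/r}, for which 1 + y^r = 1/(1-t).
  have himg : (fun t : ℝ => (t / (1 - t)) ^ (1 / r)) '' Ioo 0 1 = Ioi 0 := by
    ext x
    constructor
    · rintro ⟨t, ⟨ht0, ht1⟩, rfl⟩
      exact Real.rpow_pos_of_pos (div_pos ht0 (by linarith)) _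
    · intro hx
      have hx0 : (0 : ℝ) < x := hx
      have hxr : 0 < x ^ r := by positivity
      refine ⟨x ^ r / (1 + x ^ r), ⟨by positivity, (div_lt_one (by positivity)).2 (by linarith)⟩,
        ?_⟩
      have : x ^ r / (1 + x ^ r) / (1 - x ^ r / (1 + x ^ r)) = x ^ r := by
        field_simp; ring
      simp only [this]
      rw [← Real.rpow_mul hx0.le, mul_one_div_cancel hr.ne', Real.rpow_one]
  have hder : ∀ t ∈ Ioo (0 : ℝ) 1, HasDerivWithinAt (fun t : ℝ => (t / (1 - t)) ^ (1 / r))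
      (1 / r * (t / (1 - t)) ^ (1 / r - 1) * (1 - t) ^ (-2 : ℝ)) (Ioo 0 1) t := by
    intro t ⟨ht0, ht1⟩
    have h1 : 0 < 1 - t := by linarith
    have h2 : HasDerivAt (fun t : ℝ => t / (1 - t)) ((1 - t) ^ (-2 : ℝ)) t := by
      have := (hasDerivAt_id t).div ((hasDerivAt_id t).const_sub 1) h1.ne'
      refine this.congr_deriv ?_
      rw [Real.rpow_neg h1.le, Real.rpow_two]
      simp only [id]
      field_simp
      ring
    have h3 := h2.rpow_const (p := 1 / r) (Or.inl (div_pos ht0 h1).ne')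
    exact (h3.congr_deriv (by ring)).hasDerivWithinAt
  have hinj : InjOn (fun t : ℝ => (t / (1 - t)) ^ (1 / r)) (Ioo 0 1) := by
    rintro t ⟨ht0, ht1⟩ u ⟨hu0, hu1⟩ h
    have h1 : 0 < 1 - t := by linarith
    have h2 : 0 < 1 - u := by linarith
    have h3 := (Real.rpow_left_inj (div_pos ht0 h1).le (div_pos hu0 h2).le
      (by positivity : (1 / r) ≠ 0)).1 h
    rw [div_eq_div_iff h1.ne' h2.ne'] at h3
    linarith
  rw [blissMass, ← himg, integral_image_eq_integral_abs_deriv_smul measurableSet_Ioo hder hinj,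
    eulerBeta, intervalIntegral.integral_of_le zero_le_one, integral_Ioc_eq_integral_Ioo,
    ← integral_const_mul]
  refine setIntegral_congr_fun measurableSet_Ioo ?_
  rintro t ⟨ht0, ht1⟩
  have h1 : 0 < 1 - t := by linarith
  have h2 : 0 < t / (1 - t) := div_pos ht0 h1
  have h3 : 1 + ((t / (1 - t)) ^ (1 / r)) ^ r = (1 - t) ^ (-1 : ℝ) := by
    rw [← Real.rpow_mul h2.le, one_div_mul_cancel hr.ne', Real.rpow_one, Real.rpow_neg_one]
    field_simp; ring
  simp only [smul_eq_mul]
  rw [h3, abs_of_nonneg (by positivity), ← Real.rpow_mul h1.le, Real.div_rpow ht0.le h1.le,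
    div_eq_mul_inv (t ^ _), ← Real.rpow_neg h1.le]
  have h4 : (1 - t) ^ ((q - 1) / r - 1) =
      (1 - t) ^ (-(1 / r - 1)) * (1 - t) ^ (-2 : ℝ) * (1 - t) ^ (-1 * -(q / r)) := by
    rw [← Real.rpow_add h1, ← Real.rpow_add h1]
    congr 1; ring
  rw [h4]; ring

end Profile

/-! ### Monotone transport between densities on the half-line. -/

section Primitive

variable {a : ℝ → ℝ}

lemma intervalIntegrable_of_integrableOn_Ioi (hint : IntegrableOn a (Ioi 0)) {x y : ℝ}
    (hx : 0 ≤ x) (hy : 0 ≤ y) : IntervalIntegrable a volume x y := by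
  rw [intervalIntegrable_iff]
  exact hint.mono_set fun t ht => (le_min hx hy).trans_lt ht.1

lemma hasDerivAt_integral_of_continuousOn_Ioi (hint : IntegrableOn a (Ioi 0))
    (hcont : ContinuousOn a (Ioi 0)) {x : ℝ} (hx : 0 < x) :
    HasDerivAt (fun x => ∫ t in (0 : ℝ)..x, a t) (a x) x :=
  intervalIntegral.integral_hasDerivAt_right
    (intervalIntegrable_of_integrableOn_Ioi hint le_rfl hx.le)
    (hcont.stronglyMeasurableAtFilter isOpen_Ioi x hx)
    (hcont.continuousAt (Ioi_mem_nhds hx))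

lemma exists_integral_eq (hint : IntegrableOn a (Ioi 0)) {v : ℝ} (hv : 0 < v)
    (hv' : v < ∫ t in Ioi 0, a t) : ∃ x, 0 < x ∧ ∫ t in (0 : ℝ)..x, a t = v := by
  have hlim := intervalIntegral_tendsto_integral_Ioi 0 hint tendsto_id
  obtain ⟨X, hX0, hX⟩ := ((eventually_gt_atTop 0).and (hlim.eventually_const_lt hv')).exists
  have hcont : ContinuousOn (fun x => ∫ t in (0 : ℝ)..x, a t) (Icc 0 X) := by
    have := intervalIntegral.continuousOn_primitive_interval (a := 0) (b := X) (μ := volume)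
      (f := a) (by
        rw [uIcc_of_le hX0.le, integrableOn_Icc_iff_integrableOn_Ioc]
        exact hint.mono_set Ioc_subset_Ioi_self)
    rwa [uIcc_of_le hX0.le] at this
  obtain ⟨x, ⟨hx0, -⟩, hx⟩ := intermediate_value_Icc hX0.le hcont
    (show v ∈ Icc _ _ from ⟨by simpa using hv.le, hX.le⟩)
  refine ⟨x, hx0.lt_of_ne ?_, hx⟩
  rintro rfl
  simp only [intervalIntegral.integral_same] at hx
  exact hv.ne hx

lemma integral_mono_right (hint : IntegrableOn a (Ioi 0)) (h0 : ∀ t, 0 < t → 0 ≤ a t) {x y : ℝ}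
    (hx : 0 ≤ x) (hxy : x ≤ y) : ∫ t in (0 : ℝ)..x, a t ≤ ∫ t in (0 : ℝ)..y, a t := by
  rw [← sub_nonneg, intervalIntegral.integral_interval_sub_left
    (intervalIntegrable_of_integrableOn_Ioi hint le_rfl (hx.trans hxy))
    (intervalIntegrable_of_integrableOn_Ioi hint le_rfl hx), intervalIntegral.integral_of_le hxy]
  exact setIntegral_nonneg measurableSet_Ioc fun t ht => h0 t (hx.trans_lt ht.1)

lemma integral_strictMono_right (hint : IntegrableOn a (Ioi 0)) {x y : ℝ}
    (hx : 0 ≤ x) (hxy : x < y) (h0 : ∀ t, x < t → 0 < a t) :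
    ∫ t in (0 : ℝ)..x, a t < ∫ t in (0 : ℝ)..y, a t := by
  rw [← sub_pos, intervalIntegral.integral_interval_sub_left
    (intervalIntegrable_of_integrableOn_Ioi hint le_rfl (hx.trans hxy.le))
    (intervalIntegrable_of_integrableOn_Ioi hint le_rfl hx)]
  exact intervalIntegral.intervalIntegral_pos_of_pos_on
    (intervalIntegrable_of_integrableOn_Ioi hint hx (hx.trans hxy.le)) (fun t ht => h0 t ht.1) hxy

lemma integral_le_integral_Ioi (hint : IntegrableOn a (Ioi 0)) (h0 : ∀ t, 0 < t → 0 ≤ a t)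
    {x : ℝ} (hx : 0 ≤ x) : ∫ t in (0 : ℝ)..x, a t ≤ ∫ t in Ioi 0, a t := by
  rw [intervalIntegral.integral_of_le hx]
  refine setIntegral_mono_set hint ?_ Ioc_subset_Ioi_self.eventuallyLE
  filter_upwards [ae_restrict_mem measurableSet_Ioi] with t ht using h0 t ht

/-- Inverse of the primitive of a positive density on the half-line. -/
lemma exists_inverse_integral {w : ℝ → ℝ} (hint : IntegrableOn w (Ioi 0))
    (hcont : ContinuousOn w (Ioi 0)) (hpos : ∀ t, 0 < t → 0 < w t) :
    ∃ b : ℝ → ℝ, (∀ v ∈ Ioo 0 (∫ t in Ioi 0, w t), 0 < b v ∧ HasDerivAt b (w (b v))⁻¹ v) ∧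
      MonotoneOn b (Ioo 0 (∫ t in Ioi 0, w t)) ∧
      ∀ y, 0 < y → ∫ t in (0 : ℝ)..y, w t ∈ Ioo 0 (∫ t in Ioi 0, w t) ∧
        b (∫ t in (0 : ℝ)..y, w t) = y := by
  classical
  set B : ℝ → ℝ := fun y => ∫ t in (0 : ℝ)..y, w t with hB
  set I := ∫ t in Ioi 0, w t
  have hmono : ∀ x y, 0 ≤ x → x < y → B x < B y := fun x y hx hxy =>
    integral_strictMono_right hint hx hxy fun t ht => hpos t (hx.trans_lt ht)
  have hmem : ∀ y, 0 < y → B y ∈ Ioo 0 I := fun y hy => by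
    refine ⟨by simpa [hB] using hmono 0 y le_rfl hy, ?_⟩
    exact (hmono y (y + 1) hy.le (by linarith)).trans_le
      (integral_le_integral_Ioi hint (fun t ht => (hpos t ht).le) (by linarith))
  choose! b hb0 hb using fun v (hv : v ∈ Ioo 0 I) => exists_integral_eq hint hv.1 hv.2
  have hle : ∀ x y, 0 < x → 0 < y → B x ≤ B y → x ≤ y := fun x y hx hy h => by
    by_contra! h'
    exact absurd (hmono y x hy.le h') (not_lt.2 h)
  have hbB : ∀ y, 0 < y → b (B y) = y := fun y hy =>
    le_antisymm (hle _ _ (hb0 _ (hmem y hy)) hy (hb _ (hmem y hy)).le)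
      (hle _ _ hy (hb0 _ (hmem y hy)) (hb _ (hmem y hy)).ge)
  have hbm : MonotoneOn b (Ioo 0 I) := fun u hu v hv huv =>
    hle _ _ (hb0 _ hu) (hb0 _ hv) (by
      have h1 : B (b u) = u := hb _ hu
      have h2 : B (b v) = v := hb _ hv
      rw [h1, h2]; exact huv)
  refine ⟨b, fun v hv => ⟨hb0 v hv, ?_⟩, hbm, fun y hy => ⟨hmem y hy, hbB y hy⟩⟩
  have himg : Ioi 0 ⊆ b '' Ioo 0 I := fun y hy => ⟨B y, hmem y hy, hbB y hy⟩
  -- A monotone function whose image contains a neighbourhood of its value is continuous there, as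
  -- the inverse function rule requires.
  have hbc : ContinuousAt b v := continuousAt_of_monotoneOn_of_image_mem_nhds hbm
    (Ioo_mem_nhds hv.1 hv.2) (mem_of_superset (Ioi_mem_nhds (hb0 v hv)) himg)
  refine HasDerivAt.of_local_left_inverse hbc
    (hasDerivAt_integral_of_continuousOn_Ioi hint hcont (hb0 v hv)) (hpos _ (hb0 v hv)).ne' ?_
  filter_upwards [Ioo_mem_nhds hv.1 hv.2] with u hu using hb u hu

/-- Monotone rearrangement of a density onto a positive density of the same mass. -/
lemma exists_transport {a w : ℝ → ℝ} {S : Set ℝ} (hS : S = {t | 0 < t ∧ 0 < a t})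
    (hup : ∀ x ∈ S, Ioi x ⊆ S)
    (hai : IntegrableOn a (Ioi 0)) (hac : ContinuousOn a (Ioi 0)) (ha0 : ∀ t, 0 < t → 0 ≤ a t)
    (hwi : IntegrableOn w (Ioi 0)) (hwc : ContinuousOn w (Ioi 0)) (hw0 : ∀ t, 0 < t → 0 < w t)
    (hmass : ∫ t in Ioi 0, a t = ∫ t in Ioi 0, w t) :
    ∃ T : ℝ → ℝ, (∀ x ∈ S, 0 < T x ∧ HasDerivAt T (a x / w (T x)) x) ∧ MonotoneOn T S ∧
      T '' S = Ioi 0 := by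
  obtain ⟨b, hb, hbm, hbB⟩ := exists_inverse_integral hwi hwc hw0
  set A : ℝ → ℝ := fun x => ∫ t in (0 : ℝ)..x, a t with hA
  have hmem : ∀ x ∈ S, A x ∈ Ioo 0 (∫ t in Ioi 0, w t) := by
    intro x hx
    have hx' := hx
    rw [hS] at hx'
    obtain ⟨hx0, hax⟩ := hx'
    have hpos : ∀ t, x < t → 0 < a t := fun t ht => by
      have := hup x hx ht
      rw [hS] at this
      exact this.2
    constructor
    · refine lt_of_le_of_ne (by simpa [hA] using integral_mono_right hai ha0 le_rfl hx0.le) ?_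
      intro h
      have hd := hasDerivAt_integral_of_continuousOn_Ioi hai hac hx0
      -- If the primitive vanished at `x`, it would have a local minimum there, forcing a(x) = 0.
      have hmin : IsLocalMin A x := by
        filter_upwards [Ioi_mem_nhds hx0] with t ht
        rw [← h]
        simpa [hA] using integral_mono_right hai ha0 le_rfl (le_of_lt ht)
      exact hax.ne' (hmin.hasDerivAt_eq_zero hd)
    · rw [← hmass]
      exact (integral_strictMono_right hai hx0.le (lt_add_one x) hpos).trans_le
        (integral_le_integral_Ioi hai ha0 (by linarith))
  -- T is the primitive of `a` followed by the inverse of the primitive of `w`.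
  refine ⟨fun x => b (A x), fun x hx => ⟨(hb _ (hmem x hx)).1, ?_⟩, ?_, ?_⟩
  · have hx0 : 0 < x := by rw [hS] at hx; exact hx.1
    have := (hb _ (hmem x hx)).2.comp x (hasDerivAt_integral_of_continuousOn_Ioi hai hac hx0)
    exact this.congr_deriv (by rw [div_eq_inv_mul])
  · intro x hx y hy hxy
    have hx0 : 0 < x := by rw [hS] at hx; exact hx.1
    exact hbm (hmem x hx) (hmem y hy) (integral_mono_right hai ha0 hx0.le hxy)
  · ext y
    constructor
    · rintro ⟨x, hx, rfl⟩
      exact (hb _ (hmem x hx)).1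
    · intro hy
      obtain ⟨⟨h1, h2⟩, h3⟩ := hbB y hy
      obtain ⟨x, hx0, hx⟩ := exists_integral_eq hai h1 (hmass ▸ h2)
      -- A positive primitive at `x` needs positive density at some t ≤ x, and S is closed upwards,
      -- so x ∈ S.
      obtain ⟨t, ht, hat⟩ : ∃ t ∈ Ioc 0 x, 0 < a t := by
        by_contra! hcon
        refine h1.not_ge ?_
        rw [← hx, intervalIntegral.integral_of_le hx0.le]
        exact setIntegral_nonpos measurableSet_Ioc hcon
      have htS : t ∈ S := by rw [hS]; exact ⟨ht.1, hat⟩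
      refine ⟨x, ?_, by simp only [hA, hx, h3]⟩
      rcases ht.2.eq_or_lt with rfl | hlt
      · exact htS
      · exact hup t htS hlt

end Primitive

/-! ### The pointwise inequality along the transport map. -/

section Transport

variable {q r : ℝ}

/-- Weighted AM-GM with weights (q-r)/q and r/q, where P stands for 1+T^r. With κ = (q-r-1)/q and φ
= x^{-(q-r)κ} T^{-rκ}, the arithmetic mean is -φ'/(q-r-1), while the transport equation turns
F^{q-r} times the geometric mean into the left side. -/
lemma transport_am_gm (hr : 0 < r) (hq : r + 1 < q) {F x T P T' : ℝ} (hF : 0 < F) (hx : 0 < x)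
    (hT : 0 < T) (hP : 0 < P) (hT' : T' = F ^ q * x ^ (-(q - r)) / (T ^ r * P ^ (-(q / r)))) :
    T' * P ^ (1 - q / r) ≤ F ^ (q - r) *
      ((q - r) / q * (x ^ (-(q - r) * ((q - r - 1) / q) - 1) * T ^ (-r * ((q - r - 1) / q))) +
        r / q * (x ^ (-(q - r) * ((q - r - 1) / q)) * T ^ (-r * ((q - r - 1) / q) - 1) * T')) := by
  have hq0 : 0 < q := by linarith
  have hT'0 : 0 < T' := by rw [hT']; positivity
  have hgm := Real.geom_mean_le_arith_mean2_weighted (w₁ := (q - r) / q) (w₂ := r / q)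
    (p₁ := x ^ (-(q - r) * ((q - r - 1) / q) - 1) * T ^ (-r * ((q - r - 1) / q)))
    (p₂ := x ^ (-(q - r) * ((q - r - 1) / q)) * T ^ (-r * ((q - r - 1) / q) - 1) * T')
    (div_nonneg (by linarith) hq0.le) (by positivity) (by positivity) (by positivity)
    (by field_simp; ring)
  refine le_trans (le_of_eq ?_) (mul_le_mul_of_nonneg_left hgm (by positivity))
  -- In logarithmic coordinates an identity between monomials is a comparison of linear exponents.
  obtain ⟨f, rfl⟩ : ∃ f, F = Real.exp f := ⟨_, (Real.exp_log hF).symm⟩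
  obtain ⟨y, rfl⟩ : ∃ y, x = Real.exp y := ⟨_, (Real.exp_log hx).symm⟩
  obtain ⟨t, rfl⟩ : ∃ t, T = Real.exp t := ⟨_, (Real.exp_log hT).symm⟩
  obtain ⟨u, rfl⟩ : ∃ u, P = Real.exp u := ⟨_, (Real.exp_log hP).symm⟩
  rw [hT']
  simp only [← Real.exp_mul, ← Real.exp_add, ← Real.exp_sub]
  congr 1
  field_simp
  ring

/-- With p' = q/(q-r-1), the power (F^{q-r-1} φ)^{p'} needed for Hölder is the pull-back under T of
the integrand of `blissMass`. -/
lemma transport_holder_weight (hr : 0 < r) (hq : r + 1 < q) {F x T P T' : ℝ} (hF : 0 < F)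
    (hx : 0 < x) (hT : 0 < T) (hP : 0 < P)
    (hT' : T' = F ^ q * x ^ (-(q - r)) / (T ^ r * P ^ (-(q / r)))) :
    T' * P ^ (-(q / r)) = (F ^ (q - r - 1) *
      (x ^ (-(q - r) * ((q - r - 1) / q)) * T ^ (-r * ((q - r - 1) / q)))) ^ (q / (q - r - 1)) := by
  have hq0 : 0 < q := by linarith
  have hq1 : 0 < q - r - 1 := by linarith
  obtain ⟨f, rfl⟩ : ∃ f, F = Real.exp f := ⟨_, (Real.exp_log hF).symm⟩
  obtain ⟨y, rfl⟩ : ∃ y, x = Real.exp y := ⟨_, (Real.exp_log hx).symm⟩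
  obtain ⟨t, rfl⟩ : ∃ t, T = Real.exp t := ⟨_, (Real.exp_log hT).symm⟩
  obtain ⟨u, rfl⟩ : ∃ u, P = Real.exp u := ⟨_, (Real.exp_log hP).symm⟩
  rw [hT']
  simp only [← Real.exp_mul, ← Real.exp_add, ← Real.exp_sub]
  congr 1
  field_simp
  ring

/-- The transport step in the proof of Bliss' inequality: a decreasing weight `φ` adapted to a
non-decreasing function `F` with `∫ F^q t^{r-q}` normalised. -/
theorem exists_bliss_weight (hr : 0 < r) (hq : r + 1 < q) {F : ℝ → ℝ} (hFm : Monotone F)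
    (hFc : Continuous F) (hF0 : ∀ t, 0 ≤ F t) {S : Set ℝ} (hS : S = {t | 0 < t ∧ 0 < F t})
    (hFi : IntegrableOn (fun t => F t ^ q * t ^ (-(q - r))) (Ioi 0))
    (hmass : ∫ t in Ioi 0, F t ^ q * t ^ (-(q - r)) = blissMass q r / (q - r - 1)) :
    ∃ φ : ℝ → ℝ, (∀ x ∈ S, 0 < φ x ∧ DifferentiableAt ℝ φ x) ∧ AntitoneOn φ S ∧
      ENNReal.ofReal (blissMass q r * ((q - r) / (q - r - 1))) ≤
        ∫⁻ x in S, ENNReal.ofReal (F x ^ (q - r)) *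
          ENNReal.ofReal (1 / (q - r - 1) * -deriv φ x) ∧
      ∫⁻ x in S, ENNReal.ofReal ((F x ^ (q - r - 1) * φ x) ^ (q / (q - r - 1))) ≤
        ENNReal.ofReal (blissMass q r) := by
  have hq0 : 0 < q := by linarith
  have hq1 : 0 < q - r - 1 := by linarith
  set w : ℝ → ℝ := fun y => y ^ r * (1 + y ^ r) ^ (-(q / r)) with hw
  have hwc : ContinuousOn w (Ioi 0) := by
    refine ContinuousOn.mul ?_ ((continuousOn_one_add_rpow_rpow hr _).mono Ioi_subset_Ici_self)
    exact (Real.continuous_rpow_const hr.le).continuousOn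
  have hac : ContinuousOn (fun t => F t ^ q * t ^ (-(q - r))) (Ioi 0) := by
    refine ContinuousOn.mul ?_ ?_
    · exact ((Real.continuous_rpow_const hq0.le).comp hFc).continuousOn
    · exact continuousOn_id.rpow_const fun x hx => Or.inl (ne_of_gt hx)
  obtain ⟨T, hT, hTm, hTimg⟩ := exists_transport (a := fun t => F t ^ q * t ^ (-(q - r))) (w := w)
    (S := S)
    (by
      rw [hS]
      ext t
      refine and_congr_right fun ht => ?_
      rw [mul_pos_iff_of_pos_right (by positivity)]
      constructor
      · intro h; positivity
      · intro h
        refine (hF0 t).lt_of_ne fun h' => ?_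
        rw [← h', Real.zero_rpow hq0.ne'] at h
        exact lt_irrefl _ h)
    (by
      rw [hS]
      exact fun x hx y hy => ⟨hx.1.trans hy, hx.2.trans_le (hFm (le_of_lt hy))⟩)
    hFi hac (fun t ht => mul_nonneg (Real.rpow_nonneg (hF0 t) _) (by positivity))
    (integrableOn_rpow_mul_one_add_rpow hr hq) hwc
    (fun t ht => mul_pos (by positivity)
      (Real.rpow_pos_of_pos (one_add_rpow_pos (le_of_lt ht) r) _))
    (by rw [hmass, integral_rpow_mul_one_add_rpow hr hq])
  have hSm : MeasurableSet S := by
    rw [hS]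
    exact measurableSet_Ioi.inter (measurableSet_lt measurable_const hFc.measurable)
  set φ : ℝ → ℝ := fun x => x ^ (-(q - r) * ((q - r - 1) / q)) * T x ^ (-r * ((q - r - 1) / q))
    with hφ
  have hx0 : ∀ x ∈ S, 0 < x := fun x hx => by rw [hS] at hx; exact hx.1
  have hFp : ∀ x ∈ S, 0 < F x := fun x hx => by rw [hS] at hx; exact hx.2
  have hder : ∀ x ∈ S, HasDerivAt φ (-(q - r) * ((q - r - 1) / q) *
      x ^ (-(q - r) * ((q - r - 1) / q) - 1) * T x ^ (-r * ((q - r - 1) / q)) +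
      x ^ (-(q - r) * ((q - r - 1) / q)) * ((F x ^ q * x ^ (-(q - r)) / w (T x)) *
        (-r * ((q - r - 1) / q)) * T x ^ (-r * ((q - r - 1) / q) - 1))) x := by
    intro x hx
    exact (Real.hasDerivAt_rpow_const (Or.inl (hx0 x hx).ne')).mul
      ((hT x hx).2.rpow_const (Or.inl (hT x hx).1.ne'))
  refine ⟨φ, fun x hx => ⟨?_, (hder x hx).differentiableAt⟩, ?_, ?_, ?_⟩
  · have := hx0 x hx
    have := (hT x hx).1
    positivity
  · intro x hx y hy hxy
    have h1 := hx0 x hx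
    have h2 := (hT x hx).1
    have h3 := hTm hx hy hxy
    have h4 : 0 ≤ (q - r - 1) / q := by positivity
    exact mul_le_mul
      (Real.rpow_le_rpow_of_nonpos h1 hxy
        (mul_nonpos_of_nonpos_of_nonneg (by linarith) h4))
      (Real.rpow_le_rpow_of_nonpos h2 h3 (mul_nonpos_of_nonpos_of_nonneg (by linarith) h4))
      (by have := (hT y hy).1; positivity) (by positivity)
  -- Change of variables y = T(x), followed by the pointwise AM-GM bound.
  · rw [← integral_one_add_rpow_one_sub hr hq, ofReal_integral_eq_lintegral_ofReal
      (integrableOn_one_add_rpow_one_sub hr hq), ← hTimg,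
      lintegral_image_eq_lintegral_deriv_mul_of_monotoneOn hSm
        (fun x hx => (hT x hx).2.hasDerivWithinAt) hTm]
    · refine setLIntegral_mono' hSm fun x hx => ?_
      have h1 := hx0 x hx
      have h2 := (hT x hx).1
      have h3 := hFp x hx
      rw [← ENNReal.ofReal_mul (by positivity), ← ENNReal.ofReal_mul (by positivity)]
      refine ENNReal.ofReal_le_ofReal
        ((transport_am_gm hr hq h3 h1 h2 (one_add_rpow_pos h2.le r) rfl).trans (le_of_eq ?_))
      rw [(hder x hx).deriv]
      simp only [hw]
      congr 1
      field_simp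
      ring
    · filter_upwards [ae_restrict_mem measurableSet_Ioi] with y hy
      exact (Real.rpow_pos_of_pos (one_add_rpow_pos (le_of_lt hy) r) _).le
  · rw [blissMass, ofReal_integral_eq_lintegral_ofReal
      (integrableOn_blissMass hr hq), ← hTimg,
      lintegral_image_eq_lintegral_deriv_mul_of_monotoneOn hSm
        (fun x hx => (hT x hx).2.hasDerivWithinAt) hTm]
    · refine setLIntegral_mono' hSm fun x hx => ?_
      have h1 := hx0 x hx
      have h2 := (hT x hx).1
      have h3 := hFp x hx
      have h4 : 0 < F x ^ q * x ^ (-(q - r)) / w (T x) := by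
        simp only [hw]; positivity
      rw [← ENNReal.ofReal_mul h4.le]
      exact ENNReal.ofReal_le_ofReal
        (transport_holder_weight hr hq h3 h1 h2 (one_add_rpow_pos h2.le r) rfl).ge
    · filter_upwards [ae_restrict_mem measurableSet_Ioi] with y hy
      exact (Real.rpow_pos_of_pos (one_add_rpow_pos (le_of_lt hy) r) _).le

end Transport

/-! ### A chain rule for distribution functions. -/

/-- By inner regularity it suffices to bound a compact K inside the set. If k is its greatest
element, then ρ(K) ≤ ρ(Iic k) = ρ(Iio k) ≤ u, as there are no atoms. -/
lemma measure_measure_Iio_le (ρ : Measure ℝ) [IsFiniteMeasure ρ] [NullSingletonClass ρ] (u : ℝ≥0∞) :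
    ρ {t | ρ (Iio t) ≤ u} ≤ u := by
  have hm : Measurable fun t => ρ (Iio t) :=
    Monotone.measurable fun _ _ h => measure_mono (Iio_subset_Iio h)
  rw [(measurableSet_le hm measurable_const).measure_eq_iSup_isCompact ρ]
  refine iSup_le fun K => iSup_le fun hK => iSup_le fun hKc => ?_
  rcases K.eq_empty_or_nonempty with rfl | hne
  · simp
  obtain ⟨k, hk, hmax⟩ := hKc.exists_isGreatest hne
  calc ρ K ≤ ρ (Iic k) := measure_mono fun t ht => hmax ht
    _ = ρ (Iio k) := (measure_congr Iio_ae_eq_Iic).symm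
    _ ≤ u := hK hk

/-- Half of the chain rule `c^γ = γ ∫ F^{γ-1} dF` for the distribution function `F` of a finite
measure of mass `c` without atoms. -/
lemma rpow_measure_univ_le (ρ : Measure ℝ) [IsFiniteMeasure ρ] [NullSingletonClass ρ] {γ : ℝ} (hγ : 1 < γ) :
    ENNReal.ofReal (ρ.real univ ^ γ) ≤
      ENNReal.ofReal γ * ∫⁻ t, ENNReal.ofReal (ρ.real (Iio t) ^ (γ - 1)) ∂ρ := by
  set c := ρ.real univ with hc
  have hc0 : 0 ≤ c := measureReal_nonneg
  have hm : Measurable fun t => ρ.real (Iio t) :=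
    Monotone.measurable fun _ _ h => measureReal_mono (Iio_subset_Iio h)
  have h1 : ∫⁻ t in Ioc 0 c, ENNReal.ofReal (t ^ (γ - 1)) = ENNReal.ofReal (c ^ γ / γ) := by
    rw [← ofReal_integral_eq_lintegral_ofReal, ← intervalIntegral.integral_of_le hc0,
      integral_rpow (Or.inl (by linarith)), sub_add_cancel, Real.zero_rpow (by linarith), sub_zero]
    · exact ((intervalIntegral.intervalIntegrable_rpow' (by linarith)).1)
    · filter_upwards [ae_restrict_mem measurableSet_Ioc] with t ht
      exact Real.rpow_nonneg ht.1.le _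
  -- Layer cake on both sides: the set where ρ(Iio t) > u has ρ-mass at least c - u, which bounds
  -- the length of (0,c] above level u.
  have h2 : ∫⁻ t in Ioc 0 c, ENNReal.ofReal (t ^ (γ - 1)) ≤
      ∫⁻ t, ENNReal.ofReal (ρ.real (Iio t) ^ (γ - 1)) ∂ρ := by
    rw [lintegral_rpow_eq_lintegral_meas_lt_mul ρ (ae_of_all _ fun t => measureReal_nonneg)
      hm.aemeasurable (sub_pos.2 hγ), lintegral_rpow_eq_lintegral_meas_lt_mul (f := fun t => t) _
      (by filter_upwards [ae_restrict_mem measurableSet_Ioc] with t ht using ht.1.le)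
      aemeasurable_id (sub_pos.2 hγ)]
    refine mul_le_mul' le_rfl (setLIntegral_mono' measurableSet_Ioi fun u hu => ?_)
    have hu0 : (0 : ℝ) < u := hu
    refine mul_le_mul' ?_ le_rfl
    calc (volume.restrict (Ioc 0 c)) {a | u < a} ≤ ENNReal.ofReal (c - u) := by
          rw [Measure.restrict_apply (measurableSet_lt measurable_const measurable_id'),
            ← Real.volume_Ioc]
          exact measure_mono fun t ht => ⟨ht.1, ht.2.2⟩
      _ = ρ univ - ENNReal.ofReal u := by
          rw [ENNReal.ofReal_sub _ hu0.le, hc, ofReal_measureReal]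
      _ ≤ ρ {t | u < ρ.real (Iio t)} := by
          rw [tsub_le_iff_right]
          calc ρ univ ≤ ρ {t | u < ρ.real (Iio t)} + ρ {t | u < ρ.real (Iio t)}ᶜ :=
                (measure_add_measure_compl (measurableSet_lt measurable_const hm)).ge
            _ ≤ _ := by
                gcongr
                refine (measure_mono fun t ht => ?_).trans (measure_measure_Iio_le ρ _)
                simp only [mem_compl_iff, mem_ofPred_eq, not_lt] at ht ⊢
                rw [← ofReal_measureReal]
                exact ENNReal.ofReal_le_ofReal ht
  calc ENNReal.ofReal (c ^ γ) = ENNReal.ofReal γ * ENNReal.ofReal (c ^ γ / γ) := by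
        rw [← ENNReal.ofReal_mul (by linarith), mul_div_cancel₀ _ (by linarith)]
    _ ≤ _ := by rw [← h1]; gcongr

/-! ### Bliss' inequality under a normalisation. -/

section Bliss

variable {E : Type*} [MeasurableSpace E] {μ : Measure E} {V : E → ℝ}

lemma monotone_setLIntegral_lt (f : E → ℝ≥0∞) :
    Monotone fun t : ℝ => ∫⁻ y in {y | V y < t}, f y ∂μ :=
  fun _ _ h => lintegral_mono_set fun _ hy => lt_of_lt_of_le hy h

lemma withDensity_map_apply (hV : Measurable V) (f : E → ℝ≥0∞) {s : Set ℝ}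
    (hs : MeasurableSet s) :
    (μ.withDensity f).map V s = ∫⁻ y in V ⁻¹' s, f y ∂μ := by
  rw [Measure.map_apply hV hs, withDensity_apply _ (hV hs)]

/-- Boundedness of f thus rules out atoms and makes the distribution function F Lipschitz. -/
lemma withDensity_map_le (hV : Measurable V) (hμ : μ.map V = volume.restrict (Ioi 0))
    {f : E → ℝ≥0∞} {M : ℝ≥0∞} (hM : ∀ y, f y ≤ M) {s : Set ℝ} (hs : MeasurableSet s) :
    (μ.withDensity f).map V s ≤ M * volume (s ∩ Ioi 0) := by
  rw [withDensity_map_apply hV f hs, ← Measure.restrict_apply hs, ← hμ, Measure.map_apply hV hs,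
    ← setLIntegral_const]
  exact lintegral_mono fun y => hM y

variable {q r : ℝ}

/-- Near 0 the linear bound leaves a multiple of t^r; at infinity F is bounded and q - r > 1. -/
lemma integrableOn_rpow_mul_rpow_of_le {F : ℝ → ℝ} {M c : ℝ} (hr : 0 < r) (hq : r + 1 < q)
    (hFc : Continuous F) (hF0 : ∀ t, 0 ≤ F t) (hM : ∀ t, 0 < t → F t ≤ M * t)
    (hc : ∀ t, F t ≤ c) : IntegrableOn (fun t => F t ^ q * t ^ (-(q - r))) (Ioi 0) := by
  have hq0 : 0 < q := by linarith
  have hac : ContinuousOn (fun t => F t ^ q * t ^ (-(q - r))) (Ioi 0) := by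
    refine ContinuousOn.mul ?_ ?_
    · exact ((Real.continuous_rpow_const hq0.le).comp hFc).continuousOn
    · exact continuousOn_id.rpow_const fun x hx => Or.inl (ne_of_gt hx)
  rw [← Ioc_union_Ioi_eq_Ioi zero_le_one, integrableOn_union]
  constructor
  · refine Integrable.mono' (g := fun _ => M ^ q) (integrable_const _)
      ((hac.mono Ioc_subset_Ioi_self).aestronglyMeasurable measurableSet_Ioc) ?_
    filter_upwards [ae_restrict_mem measurableSet_Ioc] with t ht
    have ht0 := ht.1
    have hM0 : 0 ≤ M := by
      have := (hF0 t).trans (hM t ht0)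
      exact nonneg_of_mul_nonneg_left this ht0
    rw [Real.norm_of_nonneg (mul_nonneg (Real.rpow_nonneg (hF0 t) _) (by positivity))]
    calc F t ^ q * t ^ (-(q - r)) ≤ (M * t) ^ q * t ^ (-(q - r)) := by
          have := hF0 t
          have := hM t ht0
          gcongr
      _ = M ^ q * t ^ r := by
          rw [Real.mul_rpow hM0 ht0.le, mul_assoc, ← Real.rpow_add ht0]
          congr 2; ring
      _ ≤ M ^ q := mul_le_of_le_one_right (by positivity)
          (Real.rpow_le_one ht0.le ht.2 hr.le)
  · refine Integrable.mono' (g := fun t => c ^ q * t ^ (-(q - r)))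
      ((integrableOn_Ioi_rpow_of_lt (by linarith) one_pos).const_mul _)
      ((hac.mono (Ioi_subset_Ioi zero_le_one)).aestronglyMeasurable measurableSet_Ioi) ?_
    filter_upwards [ae_restrict_mem measurableSet_Ioi] with t ht
    have ht0 : (0 : ℝ) < t := zero_lt_one.trans ht
    rw [Real.norm_of_nonneg (mul_nonneg (Real.rpow_nonneg (hF0 t) _) (by positivity))]
    have := hF0 t
    have := hc t
    gcongr

/-- Normalised form of Bliss' inequality. -/
lemma blissMass_le_lintegral [SFinite μ] (hV : Measurable V)
    (hμ : μ.map V = volume.restrict (Ioi 0)) (hr : 0 < r) (hq : r + 1 < q)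
    {f : E → ℝ≥0∞} (hf : Measurable f) {M : ℝ≥0∞} (hMt : M ≠ ∞) (hM : ∀ y, f y ≤ M)
    {R : ℝ} (hR : ∀ y, R ≤ V y → f y = 0)
    (hmass : ∫⁻ t in Ioi 0, (∫⁻ y in {y | V y < t}, f y ∂μ) ^ q * ENNReal.ofReal (t ^ (-(q - r))) =
      ENNReal.ofReal (blissMass q r / (q - r - 1))) :
    ENNReal.ofReal (blissMass q r) ≤ ∫⁻ y, f y ^ (q / (r + 1)) ∂μ := by
  have hq0 : 0 < q := by linarith
  have hq1 : 0 < q - r - 1 := by linarith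
  -- Only the distribution of `f` along V matters until Hölder's inequality, which is applied on E
  -- itself; hence `f` need not be a function of V.
  set ν : Measure ℝ := (μ.withDensity f).map V with hν
  have hνle : ∀ s, MeasurableSet s → ν s ≤ M * volume (s ∩ Ioi 0) :=
    fun s hs => withDensity_map_le hV hμ hM hs
  have hνIio : ∀ t, ν (Iio t) = ∫⁻ y in {y | V y < t}, f y ∂μ :=
    fun t => withDensity_map_apply hV f measurableSet_Iio
  have hνR : ν (Ici R) = 0 := by
    rw [hν, withDensity_map_apply hV f measurableSet_Ici,
      setLIntegral_congr_fun (hV measurableSet_Ici) (g := fun _ => 0) fun y hy => hR y hy]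
    simp
  have hfin : IsFiniteMeasure ν := by
    refine ⟨?_⟩
    calc ν univ ≤ ν (Iio R) + ν (Ici R) := by
          rw [← Iio_union_Ici (a := R)]; exact measure_union_le _ _
      _ ≤ M * volume (Iio R ∩ Ioi 0) := by
          rw [hνR, add_zero]; exact hνle _ measurableSet_Iio
      _ < ∞ := by
          rw [inter_comm, Ioi_inter_Iio, Real.volume_Ioo]
          exact ENNReal.mul_lt_top hMt.lt_top ENNReal.ofReal_lt_top
  have : NullSingletonClass ν := ⟨fun x => by
    refine le_antisymm ((hνle _ (measurableSet_singleton x)).trans ?_) zero_le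
    rw [measure_mono_null inter_subset_left (Real.volume_singleton (a := x)), mul_zero]⟩
  set F : ℝ → ℝ := fun t => ν.real (Iio t) with hF
  have hFm : Monotone F := fun _ _ h => measureReal_mono (Iio_subset_Iio h)
  have hF0 : ∀ t, 0 ≤ F t := fun t => measureReal_nonneg
  have hFof : ∀ t, ENNReal.ofReal (F t) = ν (Iio t) := fun t => ofReal_measureReal
  have hFlip : ∀ x y, x ≤ y → F y ≤ F x + M.toReal * (y - x) := by
    intro x y hxy
    have h1 : ν (Iio y) ≤ ν (Iio x) + M * ENNReal.ofReal (y - x) := by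
      calc ν (Iio y) ≤ ν (Iio x) + ν (Ico x y) := by
            rw [← Iio_union_Ico_eq_Iio hxy]; exact measure_union_le _ _
        _ ≤ _ := by
            gcongr
            refine (hνle _ measurableSet_Ico).trans ?_
            gcongr
            rw [← Real.volume_Ico]
            exact measure_mono inter_subset_left
    have h2 := ENNReal.toReal_mono (by finiteness) h1
    rwa [ENNReal.toReal_add (by finiteness) (by finiteness), ENNReal.toReal_mul,
      ENNReal.toReal_ofReal (by linarith)] at h2
  have hFc : Continuous F := by
    refine (LipschitzWith.of_le_add_mul' (K := M.toReal) fun x y => ?_).continuous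
    rcases le_total x y with h | h
    · exact (hFm h).trans (le_add_of_nonneg_right (by positivity))
    · rw [Real.dist_eq, abs_of_nonneg (by linarith)]
      exact hFlip y x h
  have hFneg : ∀ t, t ≤ 0 → F t = 0 := by
    intro t ht
    have : ν (Iio t) = 0 := by
      refine le_antisymm ((hνle _ measurableSet_Iio).trans ?_) zero_le
      rw [inter_comm, Ioi_inter_Iio, Ioo_eq_empty (by linarith)]
      simp
    simp [hF, measureReal_def, this]
  have hFi := integrableOn_rpow_mul_rpow_of_le (M := M.toReal) (c := ν.real univ) hr hq hFc hF0
    (fun t ht => by simpa [hFneg 0 le_rfl] using hFlip 0 t ht.le)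
    (fun t => measureReal_mono (subset_univ _))
  have hFmass : ∫ t in Ioi 0, F t ^ q * t ^ (-(q - r)) = blissMass q r / (q - r - 1) := by
    have hnn : ∀ t ∈ Ioi (0 : ℝ), 0 ≤ F t ^ q * t ^ (-(q - r)) := fun t ht =>
      mul_nonneg (Real.rpow_nonneg (hF0 t) _) (Real.rpow_nonneg (le_of_lt ht) _)
    rw [← ENNReal.toReal_ofReal (setIntegral_nonneg measurableSet_Ioi hnn),
      ofReal_integral_eq_lintegral_ofReal hFi
        (by filter_upwards [ae_restrict_mem measurableSet_Ioi] with t ht using hnn t ht),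
      ← ENNReal.toReal_ofReal (div_nonneg (blissMass_pos hr hq).le hq1.le), ← hmass]
    congr 1
    refine setLIntegral_congr_fun measurableSet_Ioi fun t ht => ?_
    rw [ENNReal.ofReal_mul (Real.rpow_nonneg (hF0 t) _),
      ← ENNReal.ofReal_rpow_of_nonneg (hF0 t) hq0.le, hFof, hνIio]
  set S : Set ℝ := {t | 0 < t ∧ 0 < F t} with hS
  have hSo : IsOpen S := isOpen_Ioi.inter (isOpen_lt continuous_const hFc)
  obtain ⟨φ, hφ, hφa, hle, hge⟩ := exists_bliss_weight hr hq hFm hFc hF0 hS hFi hFmass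
  have hup : ∀ t ∈ S, Ioi t ⊆ S := fun t ht x hx =>
    ⟨ht.1.trans hx, ht.2.trans_le (hFm (le_of_lt hx))⟩
  have hchain : ∀ x, ENNReal.ofReal (F x ^ (q - r)) ≤ ENNReal.ofReal (q - r) *
      ∫⁻ t in Iio x, ENNReal.ofReal (F t ^ (q - r - 1)) ∂ν := by
    intro x
    have := rpow_measure_univ_le (ν.restrict (Iio x)) (γ := q - r) (by linarith)
    rw [measureReal_restrict_apply_univ] at this
    refine this.trans (le_of_eq ?_)
    congr 1
    refine setLIntegral_congr_fun measurableSet_Iio fun t ht => ?_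
    rw [measureReal_restrict_apply measurableSet_Iio, Iio_inter_Iio, min_eq_left (le_of_lt ht)]
  -- φ is antitone and positive, so its total decrease beyond `t` is at most φ(t).
  have htail : ∀ t ∈ S, ∫⁻ x in Ioi t, ENNReal.ofReal (-deriv φ x) ≤ ENNReal.ofReal (φ t) := by
    intro t ht
    rw [lintegral_deriv_eq_volume_image_of_antitoneOn measurableSet_Ioi
      (fun x hx => (hφ x (hup t ht hx)).2.hasDerivAt.hasDerivWithinAt) (hφa.mono (hup t ht))]
    refine (measure_mono (t := Ioc 0 (φ t)) ?_).trans (by rw [Real.volume_Ioc, sub_zero])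
    rintro _ ⟨x, hx, rfl⟩
    exact ⟨(hφ x (hup t ht hx)).1, hφa ht (hup t ht hx) (le_of_lt hx)⟩
  set ψ : ℝ → ℝ≥0∞ := S.indicator fun t => ENNReal.ofReal (F t ^ (q - r - 1) * φ t) with hψ
  have hψm : Measurable ψ := by
    rw [hψ, ← piecewise_eq_indicator]
    refine ContinuousOn.measurable_piecewise ?_ continuousOn_const hSo.measurableSet
    refine ENNReal.continuous_ofReal.comp_continuousOn (ContinuousOn.mul ?_ ?_)
    · exact ((Real.continuous_rpow_const hq1.le).comp hFc).continuousOn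
    · exact fun t ht => (hφ t ht).2.continuousAt.continuousWithinAt
  have hgm : Measurable fun t => ENNReal.ofReal (F t ^ (q - r - 1)) :=
    ((Real.continuous_rpow_const hq1.le).comp hFc).measurable.ennreal_ofReal
  have hdm : Measurable fun x => ENNReal.ofReal (-deriv φ x) :=
    (measurable_deriv φ).neg.ennreal_ofReal
  -- Integration by parts in the form of Tonelli: for fixed t, -φ' is integrated over x > t.
  have htonelli : ∫⁻ x in S, (∫⁻ t in Iio x, ENNReal.ofReal (F t ^ (q - r - 1)) ∂ν) *
      ENNReal.ofReal (-deriv φ x) ≤ ∫⁻ t, ψ t ∂ν := by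
    have hmeas : Measurable (Function.uncurry fun x t : ℝ => (Iio x).indicator
        (fun t => ENNReal.ofReal (F t ^ (q - r - 1))) t * ENNReal.ofReal (-deriv φ x)) := by
      refine Measurable.mul ?_ (hdm.comp measurable_fst)
      exact (hgm.comp measurable_snd).indicator (measurableSet_lt measurable_snd measurable_fst)
    calc ∫⁻ x in S, (∫⁻ t in Iio x, ENNReal.ofReal (F t ^ (q - r - 1)) ∂ν) *
          ENNReal.ofReal (-deriv φ x)
        = ∫⁻ x in S, ∫⁻ t, (Iio x).indicator
            (fun t => ENNReal.ofReal (F t ^ (q - r - 1))) t * ENNReal.ofReal (-deriv φ x) ∂ν := by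
          refine lintegral_congr fun x => ?_
          rw [lintegral_mul_const _ (hgm.indicator measurableSet_Iio),
            lintegral_indicator measurableSet_Iio]
      _ = ∫⁻ t, (∫⁻ x in S, (Iio x).indicator
            (fun t => ENNReal.ofReal (F t ^ (q - r - 1))) t * ENNReal.ofReal (-deriv φ x)) ∂ν :=
          lintegral_lintegral_swap hmeas.aemeasurable
      _ ≤ ∫⁻ t, ψ t ∂ν := by
          refine lintegral_mono fun t => ?_
          by_cases ht : t ∈ S
          · calc _ = ∫⁻ x in S, ENNReal.ofReal (F t ^ (q - r - 1)) *
                    (Ioi t).indicator (fun x => ENNReal.ofReal (-deriv φ x)) x := by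
                  refine lintegral_congr fun x => ?_
                  by_cases hx : t < x <;> simp [hx]
              _ ≤ ENNReal.ofReal (F t ^ (q - r - 1)) *
                    ∫⁻ x in Ioi t, ENNReal.ofReal (-deriv φ x) := by
                  rw [lintegral_const_mul _ (hdm.indicator measurableSet_Ioi),
                    lintegral_indicator measurableSet_Ioi, Measure.restrict_restrict
                    measurableSet_Ioi]
                  gcongr
                  exact inter_subset_left
              _ ≤ ENNReal.ofReal (F t ^ (q - r - 1)) * ENNReal.ofReal (φ t) := by
                  gcongr; exact htail t ht
              _ = ψ t := by
                  rw [hψ, indicator_of_mem ht, ENNReal.ofReal_mul (Real.rpow_nonneg (hF0 t) _)]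
          · have hz : F t = 0 := by
              rcases le_or_gt t 0 with h | h
              · exact hFneg t h
              · exact le_antisymm (not_lt.1 fun h' => ht ⟨h, h'⟩) (hF0 t)
            have : ∀ x, (Iio x).indicator (fun t => ENNReal.ofReal (F t ^ (q - r - 1))) t = 0 := by
              intro x
              simp [indicator_apply, hz, Real.zero_rpow hq1.ne']
            simp [this]
  have hconj : (q / (r + 1)).HolderConjugate (q / (q - r - 1)) := by
    rw [Real.holderConjugate_iff]
    refine ⟨by rw [one_lt_div (by linarith)]; exact hq, ?_⟩
    field_simp
    ring
  have hholder : ∫⁻ t, ψ t ∂ν ≤ (∫⁻ y, f y ^ (q / (r + 1)) ∂μ) ^ (1 / (q / (r + 1))) *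
      ENNReal.ofReal (blissMass q r) ^ (1 / (q / (q - r - 1))) := by
    rw [hν, lintegral_map hψm hV]
    refine (lintegral_withDensity_eq_lintegral_mul _ hf (hψm.comp hV)).trans_le ?_
    refine (ENNReal.lintegral_mul_le_Lp_mul_Lq μ hconj hf.aemeasurable
      (hψm.comp hV).aemeasurable).trans ?_
    refine mul_le_mul' le_rfl (ENNReal.rpow_le_rpow ?_ (by positivity))
    have h1 : ∫⁻ y, (ψ ∘ V) y ^ (q / (q - r - 1)) ∂μ =
        ∫⁻ t in Ioi 0, ψ t ^ (q / (q - r - 1)) := by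
      rw [← hμ, lintegral_map (hψm.pow_const _) hV]
      rfl
    rw [h1]
    refine le_trans (le_of_eq ?_) hge
    have h2 : ∀ t, ψ t ^ (q / (q - r - 1)) = S.indicator (fun t =>
        ENNReal.ofReal ((F t ^ (q - r - 1) * φ t) ^ (q / (q - r - 1)))) t := by
      intro t
      by_cases ht : t ∈ S
      · rw [hψ, indicator_of_mem ht, indicator_of_mem ht, ENNReal.ofReal_rpow_of_nonneg
          (mul_nonneg (Real.rpow_nonneg (hF0 t) _) (hφ t ht).1.le) (by positivity)]
      · rw [hψ, indicator_of_notMem ht, indicator_of_notMem ht, ENNReal.zero_rpow_of_pos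
          (by positivity)]
    simp_rw [h2]
    rw [lintegral_indicator hSo.measurableSet, Measure.restrict_restrict hSo.measurableSet,
      inter_eq_left.2 fun t ht => ht.1]
  set N := ∫⁻ y, f y ^ (q / (r + 1)) ∂μ with hN
  have hI := blissMass_pos hr hq
  set I := blissMass q r with hIdef
  -- The same factor (q-r)/(q-r-1) comes from the profile integral on the left and from the chain
  -- rule on the right; cancelling it leaves I ≤ N^{1/p} I^{1/p'}.
  have hmain : ENNReal.ofReal ((q - r) / (q - r - 1)) * ENNReal.ofReal I ≤
      ENNReal.ofReal ((q - r) / (q - r - 1)) *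
        (N ^ (1 / (q / (r + 1))) * ENNReal.ofReal I ^ (1 / (q / (q - r - 1)))) := by
    have hc0 : 0 ≤ (q - r) / (q - r - 1) := div_nonneg (by linarith) hq1.le
    calc ENNReal.ofReal ((q - r) / (q - r - 1)) * ENNReal.ofReal I
        = ENNReal.ofReal (I * ((q - r) / (q - r - 1))) := by
          rw [← ENNReal.ofReal_mul hc0, mul_comm]
      _ ≤ ∫⁻ x in S, ENNReal.ofReal (F x ^ (q - r)) *
          ENNReal.ofReal (1 / (q - r - 1) * -deriv φ x) := hle
      _ ≤ ∫⁻ x in S, ENNReal.ofReal ((q - r) / (q - r - 1)) *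
          ((∫⁻ t in Iio x, ENNReal.ofReal (F t ^ (q - r - 1)) ∂ν) *
            ENNReal.ofReal (-deriv φ x)) := by
          refine lintegral_mono fun x => ?_
          refine (mul_le_mul_left (hchain x) _).trans (le_of_eq ?_)
          rw [ENNReal.ofReal_mul (by positivity), div_eq_mul_one_div (q - r),
            ENNReal.ofReal_mul (by linarith)]
          ring
      _ ≤ ENNReal.ofReal ((q - r) / (q - r - 1)) * ∫⁻ t, ψ t ∂ν := by
          rw [lintegral_const_mul' _ _ ENNReal.ofReal_ne_top]
          gcongr
      _ ≤ _ := by gcongr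
  have hcpos : 0 < (q - r) / (q - r - 1) := div_pos (by linarith) hq1
  rw [ENNReal.mul_le_mul_iff_right (by simpa using hcpos) ENNReal.ofReal_ne_top] at hmain
  have hI0 : ENNReal.ofReal I ≠ 0 := by simpa using hI
  have hsplit : ENNReal.ofReal I = ENNReal.ofReal I ^ (1 / (q / (r + 1))) *
      ENNReal.ofReal I ^ (1 / (q / (q - r - 1))) := by
    rw [← ENNReal.rpow_add _ _ hI0 ENNReal.ofReal_ne_top, one_div, one_div,
      hconj.inv_add_inv_eq_one, ENNReal.rpow_one]
  have h5 : ENNReal.ofReal I ^ (1 / (q / (r + 1))) ≤ N ^ (1 / (q / (r + 1))) := by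
    refine (ENNReal.mul_le_mul_iff_left (c := ENNReal.ofReal I ^ (1 / (q / (q - r - 1))))
      ?_ ?_).1 ?_
    · simp [ENNReal.rpow_eq_zero_iff, hI0]
    · exact ENNReal.rpow_ne_top_of_nonneg (by positivity) ENNReal.ofReal_ne_top
    · rwa [← hsplit]
  exact (ENNReal.rpow_le_rpow_iff (by positivity)).1 h5

end Bliss

/-! ### Bliss' inequality in general, and its equality case. -/

section Bliss

variable {E : Type*} [MeasurableSpace E] {μ : Measure E} {V : E → ℝ} {q r : ℝ}

lemma measure_preimage_Iio_le (hV : Measurable V) (hμ : μ.map V = volume.restrict (Ioi 0)) (t : ℝ) :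
    μ {y | V y < t} = ENNReal.ofReal t := by
  have : μ {y | V y < t} = μ.map V (Iio t) := (Measure.map_apply hV measurableSet_Iio).symm
  rw [this, hμ, Measure.restrict_apply measurableSet_Iio, inter_comm, Ioi_inter_Iio,
    Real.volume_Ioo, sub_zero]

/-- Finiteness is what allows rescaling to the normalised mass. Here F(t) is at most both Mt and MR.
-/
lemma bliss_lintegral_lt_top (hV : Measurable V) (hμ : μ.map V = volume.restrict (Ioi 0))
    (hr : 0 < r) (hq : r + 1 < q) {f : E → ℝ≥0∞} {M : ℝ≥0∞} (hMt : M ≠ ∞)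
    (hM : ∀ y, f y ≤ M) {R : ℝ} (hR : ∀ y, R ≤ V y → f y = 0) :
    ∫⁻ t in Ioi 0, (∫⁻ y in {y | V y < t}, f y ∂μ) ^ q * ENNReal.ofReal (t ^ (-(q - r))) < ∞ := by
  have hq0 : 0 < q := by linarith
  have hle : ∀ t, ∫⁻ y in {y | V y < t}, f y ∂μ ≤ M * ENNReal.ofReal t := fun t => by
    rw [← measure_preimage_Iio_le hV hμ t, ← setLIntegral_const]
    exact lintegral_mono hM
  have hle' : ∀ t, ∫⁻ y in {y | V y < t}, f y ∂μ ≤ M * ENNReal.ofReal R := fun t => by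
    refine le_trans ?_ (hle R)
    rw [← lintegral_indicator (measurableSet_lt hV measurable_const),
      ← lintegral_indicator (measurableSet_lt hV measurable_const)]
    refine lintegral_mono fun y => ?_
    by_cases hy : V y < R
    · rw [indicator_of_mem (s := {y | V y < R}) hy]
      exact indicator_le_self _ _ _
    · simp [indicator_apply, hR y (not_lt.1 hy)]
  set F : ℝ → ℝ := fun t => max 0 (min (M.toReal * t) (M.toReal * R)) with hF
  have hFof : ∀ t, ∫⁻ y in {y | V y < t}, f y ∂μ ≤ ENNReal.ofReal (F t) := fun t => by
    rw [hF, ENNReal.ofReal_max, ENNReal.ofReal_min, ENNReal.ofReal_mul ENNReal.toReal_nonneg,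
      ENNReal.ofReal_mul ENNReal.toReal_nonneg, ENNReal.ofReal_toReal hMt]
    exact le_max_of_le_right (le_min (hle t) (hle' t))
  have hint := integrableOn_rpow_mul_rpow_of_le (F := F) (M := M.toReal)
    (c := max 0 (M.toReal * R)) hr hq (by fun_prop) (fun t => le_max_left _ _)
    (fun t ht => max_le (by positivity) (min_le_left _ _))
    (fun t => max_le_max le_rfl (min_le_right _ _))
  refine lt_of_le_of_lt ?_ hint.lintegral_lt_top
  refine setLIntegral_mono' measurableSet_Ioi fun t ht => ?_
  rw [ENNReal.ofReal_mul (Real.rpow_nonneg (le_max_left _ _) _),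
    ← ENNReal.ofReal_rpow_of_nonneg (le_max_left _ _) hq0.le]
  gcongr
  exact hFof t

/-- Both sides are homogeneous of degree q in f, so the normalised case suffices. -/
lemma bliss_lintegral_le_of_bounded [SFinite μ] (hV : Measurable V)
    (hμ : μ.map V = volume.restrict (Ioi 0)) (hr : 0 < r) (hq : r + 1 < q)
    {f : E → ℝ≥0∞} (hf : Measurable f) {M : ℝ≥0∞} (hMt : M ≠ ∞)
    (hM : ∀ y, f y ≤ M) {R : ℝ} (hR : ∀ y, R ≤ V y → f y = 0) :
    ∫⁻ t in Ioi 0, (∫⁻ y in {y | V y < t}, f y ∂μ) ^ q * ENNReal.ofReal (t ^ (-(q - r))) ≤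
      ENNReal.ofReal (blissMass q r ^ (-r) / (q - r - 1)) *
        (∫⁻ y, f y ^ (q / (r + 1)) ∂μ) ^ (r + 1) := by
  have hq0 : 0 < q := by linarith
  have hq1 : 0 < q - r - 1 := by linarith
  have hI := blissMass_pos hr hq
  have hAt := (bliss_lintegral_lt_top hV hμ hr hq hMt hM hR).ne
  set A := ∫⁻ t in Ioi 0, (∫⁻ y in {y | V y < t}, f y ∂μ) ^ q * ENNReal.ofReal (t ^ (-(q - r)))
    with hA
  rcases eq_or_ne A 0 with h0 | h0
  · rw [h0]; exact zero_le
  have hA0 : 0 < A.toReal := ENNReal.toReal_pos h0 hAt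
  set I := blissMass q r with hIdef
  -- Chosen so that l^q A is the normalised mass I/(q-r-1).
  set l : ℝ := (I / (q - r - 1) / A.toReal) ^ (1 / q) with hl
  have hl0 : 0 < l := by positivity
  have hlq : ENNReal.ofReal l ^ q = ENNReal.ofReal (I / (q - r - 1) / A.toReal) := by
    rw [ENNReal.ofReal_rpow_of_pos hl0, hl, ← Real.rpow_mul (by positivity),
      one_div_mul_cancel hq0.ne', Real.rpow_one]
  have hmass : ∫⁻ t in Ioi 0, (∫⁻ y in {y | V y < t}, ENNReal.ofReal l * f y ∂μ) ^ q *
      ENNReal.ofReal (t ^ (-(q - r))) = ENNReal.ofReal (I / (q - r - 1)) := by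
    simp_rw [lintegral_const_mul _ hf, ENNReal.mul_rpow_of_nonneg _ _ hq0.le, mul_assoc]
    rw [lintegral_const_mul' _ _ (by rw [hlq]; exact ENNReal.ofReal_ne_top), ← hA, hlq,
      ENNReal.ofReal_div_of_pos hA0, ENNReal.ofReal_toReal hAt,
      ENNReal.div_mul_cancel h0 hAt]
  have key := blissMass_le_lintegral hV hμ hr hq (hf.const_mul (ENNReal.ofReal l))
    (M := ENNReal.ofReal l * M) (ENNReal.mul_ne_top ENNReal.ofReal_ne_top hMt)
    (fun y => by gcongr; exact hM y) (R := R) (fun y hy => by rw [hR y hy, mul_zero]) hmass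
  have hp0 : 0 < q / (r + 1) := by positivity
  simp_rw [ENNReal.mul_rpow_of_nonneg _ _ hp0.le] at key
  rw [lintegral_const_mul _ (hf.pow_const _)] at key
  set N := ∫⁻ y, f y ^ (q / (r + 1)) ∂μ with hN
  have key2 := ENNReal.rpow_le_rpow key (show 0 ≤ r + 1 by linarith)
  rw [ENNReal.mul_rpow_of_nonneg _ _ (by linarith), ← ENNReal.rpow_mul,
    div_mul_cancel₀ _ (by linarith), hlq, ENNReal.ofReal_div_of_pos hA0,
    ENNReal.ofReal_toReal hAt] at key2
  have hc : ENNReal.ofReal (I ^ (-r) / (q - r - 1)) =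
      ENNReal.ofReal (I / (q - r - 1)) / ENNReal.ofReal I ^ (r + 1) := by
    rw [ENNReal.ofReal_rpow_of_pos hI, ← ENNReal.ofReal_div_of_pos (by positivity)]
    congr 1
    rw [Real.rpow_neg hI.le, Real.rpow_add hI, Real.rpow_one]
    field_simp
  have hI1 : ENNReal.ofReal I ^ (r + 1) ≠ 0 := by
    rw [ENNReal.ofReal_rpow_of_pos hI]; simp; positivity
  have hI2 : ENNReal.ofReal I ^ (r + 1) ≠ ∞ := by
    rw [ENNReal.ofReal_rpow_of_pos hI]; exact ENNReal.ofReal_ne_top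
  calc A = A * (ENNReal.ofReal I ^ (r + 1) / ENNReal.ofReal I ^ (r + 1)) := by
        rw [ENNReal.div_self hI1 hI2, mul_one]
    _ ≤ A * (ENNReal.ofReal (I / (q - r - 1)) / A * N ^ (r + 1) / ENNReal.ofReal I ^ (r + 1)) := by
        gcongr
    _ = (ENNReal.ofReal (I / (q - r - 1)) / A * A) * N ^ (r + 1) / ENNReal.ofReal I ^ (r + 1) := by
        simp only [div_eq_mul_inv]; ring
    _ = _ := by
        rw [ENNReal.div_mul_cancel h0 hAt, hc]
        simp only [div_eq_mul_inv]; ring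

/-- **Bliss' inequality** on a measure space with a function `V` that pushes the measure forward
to Lebesgue measure on the half-line. -/
theorem bliss_lintegral_le [SFinite μ] (hV : Measurable V)
    (hμ : μ.map V = volume.restrict (Ioi 0)) (hr : 0 < r) (hq : r + 1 < q)
    {f : E → ℝ≥0∞} (hf : Measurable f) :
    ∫⁻ t in Ioi 0, (∫⁻ y in {y | V y < t}, f y ∂μ) ^ q * ENNReal.ofReal (t ^ (-(q - r))) ≤
      ENNReal.ofReal (blissMass q r ^ (-r) / (q - r - 1)) *
        (∫⁻ y, f y ^ (q / (r + 1)) ∂μ) ^ (r + 1) := by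
  have hq0 : 0 < q := by linarith
  -- Truncation in both value and V gives bounded functions, zero for V ≥ k, increasing to `f`.
  set g : ℕ → E → ℝ≥0∞ := fun k => {y | V y < k}.indicator fun y => min (f y) k with hg
  have hgm : ∀ k, Measurable (g k) := fun k =>
    (hf.min measurable_const).indicator (hV measurableSet_Iio)
  have hgmono : ∀ y, Monotone fun k => g k y := by
    intro y k l hkl
    have hkl' : (k : ℝ) ≤ l := by exact_mod_cast hkl
    by_cases hy : V y < k
    · have hy' : V y < l := hy.trans_le hkl'
      simp only [hg, indicator_apply, mem_ofPred_eq, hy, hy', if_true]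
      gcongr
    · simp [hg, indicator_apply, hy]
  have hgle : ∀ k y, g k y ≤ f y := fun k y => by
    by_cases hy : V y < k <;> simp [hg, hy]
  have hglim : ∀ y, Tendsto (fun k => g k y) atTop (𝓝 (f y)) := by
    intro y
    have h1 : Tendsto (fun k : ℕ => min (f y) (k : ℝ≥0∞)) atTop (𝓝 (min (f y) ∞)) :=
      tendsto_const_nhds.min ENNReal.tendsto_nat_nhds_top
    rw [min_eq_left le_top] at h1
    refine h1.congr' ?_
    obtain ⟨k₀, hk₀⟩ := exists_nat_gt (V y)
    filter_upwards [eventually_ge_atTop k₀] with k hk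
    have : V y < k := hk₀.trans_le (by exact_mod_cast hk)
    simp [hg, this]
  have hΦm : ∀ k, Measurable fun t : ℝ =>
      (∫⁻ y in {y | V y < t}, g k y ∂μ) ^ q * ENNReal.ofReal (t ^ (-(q - r))) := fun k =>
    ((monotone_setLIntegral_lt (g k)).measurable.pow_const q).mul
      (Measurable.ennreal_ofReal (measurable_id.pow_const _))
  have hlim : Tendsto (fun k => ∫⁻ t in Ioi 0, (∫⁻ y in {y | V y < t}, g k y ∂μ) ^ q *
      ENNReal.ofReal (t ^ (-(q - r)))) atTop
      (𝓝 (∫⁻ t in Ioi 0, (∫⁻ y in {y | V y < t}, f y ∂μ) ^ q *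
        ENNReal.ofReal (t ^ (-(q - r))))) := by
    refine lintegral_tendsto_of_tendsto_of_monotone (fun k => (hΦm k).aemeasurable)
      (ae_of_all _ fun t k l hkl => ?_) (ae_of_all _ fun t => ?_)
    · have : ∀ y, g k y ≤ g l y := fun y => hgmono y hkl
      dsimp only
      gcongr
      exact this _
    · refine ENNReal.Tendsto.mul_const ?_ (Or.inr ENNReal.ofReal_ne_top)
      refine (ENNReal.continuous_rpow_const.tendsto _).comp ?_
      exact lintegral_tendsto_of_tendsto_of_monotone (fun k => (hgm k).aemeasurable)
        (ae_of_all _ hgmono) (ae_of_all _ hglim)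
  refine le_of_tendsto' hlim fun k => ?_
  refine (bliss_lintegral_le_of_bounded hV hμ hr hq (hgm k) (M := k) (ENNReal.natCast_ne_top k)
    (fun y => ?_) (R := k) (fun y hy => ?_)).trans ?_
  · by_cases hy : V y < k <;> simp [hg, hy]
  · simp [hg, not_lt.2 hy]
  · gcongr
    exact hgle k _

/-- The extremal function of Bliss' inequality. -/
noncomputable def blissExtremal (r t : ℝ) : ℝ := (1 + t ^ r) ^ (-((r + 1) / r))

lemma blissExtremal_nonneg {t : ℝ} (ht : 0 ≤ t) (r : ℝ) : 0 ≤ blissExtremal r t :=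
  (Real.rpow_pos_of_pos (one_add_rpow_pos ht r) _).le

/-- The function s(1+s^r)^{-1/r} is a primitive of the extremal profile. -/
lemma setLIntegral_blissExtremal (hr : 0 < r) {t : ℝ} (ht : 0 < t) :
    ∫⁻ s in Ioo 0 t, ENNReal.ofReal (blissExtremal r s) =
      ENNReal.ofReal (t * (1 + t ^ r) ^ (-(1 / r))) := by
  have hcont : ContinuousOn (blissExtremal r) (Icc 0 t) :=
    (continuousOn_one_add_rpow_rpow hr _).mono Icc_subset_Ici_self
  have hint : IntervalIntegrable (blissExtremal r) volume 0 t :=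
    hcont.intervalIntegrable_of_Icc ht.le
  have hderiv : ∀ s ∈ Ioo 0 t, HasDerivAt (fun s : ℝ => s * (1 + s ^ r) ^ (-(1 / r)))
      (blissExtremal r s) s := by
    intro s hs
    have hP := one_add_rpow_pos hs.1.le r
    have h1 : HasDerivAt (fun y : ℝ => 1 + y ^ r) (r * s ^ (r - 1)) s :=
      (Real.hasDerivAt_rpow_const (Or.inl hs.1.ne')).const_add 1
    have h2 := (hasDerivAt_id s).mul (h1.rpow_const (p := -(1 / r)) (Or.inl hP.ne'))
    refine h2.congr_deriv ?_
    have h3 : -((r + 1) / r) = -(1 / r) - 1 := by field_simp; ring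
    have h4 : (1 + s ^ r) ^ (-(1 / r)) = (1 + s ^ r) ^ (-(1 / r) - 1) * (1 + s ^ r) := by
      rw [← Real.rpow_add_one hP.ne']; congr 1; ring
    rw [blissExtremal, h3, h4, Real.rpow_sub_one hs.1.ne']
    have := hs.1.ne'
    simp only [id]
    field_simp
    ring
  have hFTC := intervalIntegral.integral_eq_sub_of_hasDerivAt_of_le ht.le
    (f := fun s : ℝ => s * (1 + s ^ r) ^ (-(1 / r)))
    (continuousOn_id.mul ((continuousOn_one_add_rpow_rpow hr _).mono Icc_subset_Ici_self))
    hderiv hint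
  rw [zero_mul, sub_zero, intervalIntegral.integral_of_le ht.le,
    integral_Ioc_eq_integral_Ioo] at hFTC
  rw [← hFTC, ofReal_integral_eq_lintegral_ofReal]
  · exact hcont.integrableOn_Icc.mono_set Ioo_subset_Icc_self
  · filter_upwards [ae_restrict_mem measurableSet_Ioo] with s hs
    exact blissExtremal_nonneg hs.1.le r

lemma measurable_blissExtremal (r : ℝ) : Measurable (blissExtremal r) := by
  unfold blissExtremal
  fun_prop

lemma lintegral_blissExtremal_rpow (hV : Measurable V) (hμ : μ.map V = volume.restrict (Ioi 0))
    (hr : 0 < r) (hq : r + 1 < q) :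
    ∫⁻ y, ENNReal.ofReal (blissExtremal r (V y)) ^ (q / (r + 1)) ∂μ =
      ENNReal.ofReal (blissMass q r) := by
  have hq0 : 0 < q := by linarith
  have h1 : ∫⁻ y, ENNReal.ofReal (blissExtremal r (V y)) ^ (q / (r + 1)) ∂μ =
      ∫⁻ t in Ioi 0, ENNReal.ofReal (blissExtremal r t) ^ (q / (r + 1)) := by
    rw [← hμ, lintegral_map ((measurable_blissExtremal r).ennreal_ofReal.pow_const _) hV]
  rw [h1, blissMass, ofReal_integral_eq_lintegral_ofReal (integrableOn_blissMass hr hq)]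
  · refine setLIntegral_congr_fun measurableSet_Ioi fun t ht => ?_
    have hP := one_add_rpow_pos (le_of_lt ht) r
    rw [ENNReal.ofReal_rpow_of_nonneg (blissExtremal_nonneg (le_of_lt ht) r) (by positivity),
      blissExtremal, ← Real.rpow_mul hP.le]
    congr 2
    field_simp
  · filter_upwards [ae_restrict_mem measurableSet_Ioi] with y hy
    exact (Real.rpow_pos_of_pos (one_add_rpow_pos (le_of_lt hy) r) _).le

/-- Equality in Bliss' inequality. -/
lemma bliss_lintegral_extremal (hV : Measurable V) (hμ : μ.map V = volume.restrict (Ioi 0))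
    (hr : 0 < r) (hq : r + 1 < q) :
    ∫⁻ t in Ioi 0, (∫⁻ y in {y | V y < t}, ENNReal.ofReal (blissExtremal r (V y)) ∂μ) ^ q *
      ENNReal.ofReal (t ^ (-(q - r))) = ENNReal.ofReal (blissMass q r / (q - r - 1)) := by
  have hq0 : 0 < q := by linarith
  rw [← integral_rpow_mul_one_add_rpow hr hq, ofReal_integral_eq_lintegral_ofReal
    (integrableOn_rpow_mul_one_add_rpow hr hq)]
  -- Here F = t(1+t^r)^{-1/r}, so F^q t^{r-q} is exactly the target density t^r(1+t^r)^{-q/r}.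
  · refine setLIntegral_congr_fun measurableSet_Ioi fun t ht => ?_
    have ht0 : (0 : ℝ) < t := ht
    have hP := one_add_rpow_pos ht0.le r
    have h1 : ∫⁻ y in {y | V y < t}, ENNReal.ofReal (blissExtremal r (V y)) ∂μ =
        ∫⁻ s in Ioo 0 t, ENNReal.ofReal (blissExtremal r s) := by
      rw [← Ioi_inter_Iio, inter_comm, ← Measure.restrict_restrict measurableSet_Iio, ← hμ,
        setLIntegral_map measurableSet_Iio (measurable_blissExtremal r).ennreal_ofReal hV]
      rfl
    rw [h1, setLIntegral_blissExtremal hr ht0, ENNReal.ofReal_rpow_of_nonneg (by positivity) hq0.le,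
      ← ENNReal.ofReal_mul (by positivity), Real.mul_rpow ht0.le (by positivity),
      ← Real.rpow_mul hP.le, mul_right_comm, ← Real.rpow_add ht0]
    congr 3 <;> ring
  · filter_upwards [ae_restrict_mem measurableSet_Ioi] with y hy
    have hy0 : (0 : ℝ) < y := hy
    have := one_add_rpow_pos hy0.le r
    positivity

end Bliss

/-! ### Reduction of one Euclidean factor to the half-line. -/

/-- The volume of the open ball centred at the origin with `x` on its boundary. -/
noncomputable def ballVol {n : ℕ} (x : EuclideanSpace ℝ (Fin n)) : ℝ :=
  volume.real (Metric.ball (0 : EuclideanSpace ℝ (Fin n)) ‖x‖)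

section BallVol

variable {n : ℕ}

lemma ballVol_eq (hn : 0 < n) (x : EuclideanSpace ℝ (Fin n)) :
    ballVol x = ‖x‖ ^ n * volume.real (Metric.ball (0 : EuclideanSpace ℝ (Fin n)) 1) := by
  have : Nonempty (Fin n) := ⟨⟨0, hn⟩⟩
  rw [ballVol, measureReal_def, Measure.addHaar_ball _ _ (norm_nonneg x), ENNReal.toReal_mul,
    ENNReal.toReal_ofReal (by positivity), finrank_euclideanSpace_fin, measureReal_def]

lemma volume_real_unitBall_pos :
    0 < volume.real (Metric.ball (0 : EuclideanSpace ℝ (Fin n)) 1) :=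
  ENNReal.toReal_pos (Metric.measure_ball_pos _ _ one_pos).ne' measure_ball_lt_top.ne

lemma ballVol_nonneg (x : EuclideanSpace ℝ (Fin n)) : 0 ≤ ballVol x := measureReal_nonneg

lemma measurable_ballVol (hn : 0 < n) :
    Measurable (ballVol : EuclideanSpace ℝ (Fin n) → ℝ) := by
  simp_rw [funext (ballVol_eq hn)]
  fun_prop

lemma setOf_ballVol_lt (hn : 0 < n) (x : EuclideanSpace ℝ (Fin n)) :
    {y : EuclideanSpace ℝ (Fin n) | ballVol y < ballVol x} = Metric.ball 0 ‖x‖ := by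
  ext y
  rw [mem_ball_zero_iff, mem_ofPred_eq, ballVol_eq hn, ballVol_eq hn,
    mul_lt_mul_iff_left₀ volume_real_unitBall_pos,
    pow_lt_pow_iff_left₀ (norm_nonneg _) (norm_nonneg _) hn.ne']

lemma volume_setOf_ballVol_lt (hn : 0 < n) (t : ℝ) :
    volume {y : EuclideanSpace ℝ (Fin n) | ballVol y < t} = ENNReal.ofReal t := by
  rcases le_or_gt t 0 with ht | ht
  · rw [ENNReal.ofReal_of_nonpos ht, show {y : EuclideanSpace ℝ (Fin n) | ballVol y < t} = ∅ from
      eq_empty_of_forall_notMem fun y hy => (ht.trans (ballVol_nonneg y)).not_gt hy, measure_empty]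
  · have hc := volume_real_unitBall_pos (n := n)
    set c := volume.real (Metric.ball (0 : EuclideanSpace ℝ (Fin n)) 1)
    have : Nonempty (Fin n) := ⟨⟨0, hn⟩⟩
    -- A point at the radius whose ball has volume t.
    obtain ⟨x, hx⟩ := exists_norm_eq (EuclideanSpace ℝ (Fin n))
      (c := (t / c) ^ (1 / (n : ℝ))) (by positivity)
    have hxt : ballVol x = t := by
      rw [ballVol_eq hn, hx, ← Real.rpow_natCast, ← Real.rpow_mul (by positivity),
        one_div_mul_cancel (by positivity), Real.rpow_one]
      exact div_mul_cancel₀ _ hc.ne'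
    rw [← hxt, setOf_ballVol_lt hn, ballVol, ofReal_measureReal]

/-- The volume of balls pushes Lebesgue measure forward to Lebesgue measure on the half-line. -/
lemma map_ballVol (hn : 0 < n) :
    (volume : Measure (EuclideanSpace ℝ (Fin n))).map ballVol = volume.restrict (Ioi 0) := by
  have hI : ∀ t, (volume : Measure (EuclideanSpace ℝ (Fin n))).map ballVol (Iio t) =
      ENNReal.ofReal t := fun t => by
    rw [Measure.map_apply (measurable_ballVol hn) measurableSet_Iio, ← volume_setOf_ballVol_lt hn t]
    rfl
  have hJ : ∀ t : ℝ, volume.restrict (Ioi 0) (Iio t) = ENNReal.ofReal t := fun t => by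
    rw [Measure.restrict_apply measurableSet_Iio, inter_comm, Ioi_inter_Iio, Real.volume_Ioo,
      sub_zero]
  have hfin : ∀ a b : ℝ, (volume : Measure (EuclideanSpace ℝ (Fin n))).map ballVol (Ico a b) ≠ ∞ :=
    fun a b => ((measure_mono Ico_subset_Iio_self).trans_lt
      ((hI b).trans_lt ENNReal.ofReal_lt_top)).ne
  refine Measure.ext_of_Ico' _ _ (fun a b _ => hfin a b) fun a b hab => ?_
  -- Agreement on half-lines passes to half-open intervals by subtraction, the values being finite.
  have hd : Ico a b = Iio b \ Iio a := by
    ext t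
    simp only [mem_Ico, Set.mem_sdiff, mem_Iio, not_lt]
    exact and_comm
  rw [hd, measure_sdiff (Iio_subset_Iio hab.le) measurableSet_Iio.nullMeasurableSet
    ((hI a).trans_lt ENNReal.ofReal_lt_top).ne,
    measure_sdiff (Iio_subset_Iio hab.le) measurableSet_Iio.nullMeasurableSet
    ((hJ a).trans_lt ENNReal.ofReal_lt_top).ne, hI, hI, hJ, hJ]

/-- The integral kernel of the fractional Hardy operator of order `a n` on `ℝⁿ`. -/
noncomputable def hardyKernel (a : ℝ) (x y : EuclideanSpace ℝ (Fin n)) : ℝ≥0∞ :=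
  (Metric.ball 0 ‖x‖).indicator (fun _ => ENNReal.ofReal (1 / ballVol x ^ (1 - a))) y

lemma measurable_hardyKernel (hn : 0 < n) (a : ℝ) :
    Measurable (Function.uncurry (hardyKernel (n := n) a)) := by
  have h1 : Measurable fun z : EuclideanSpace ℝ (Fin n) × EuclideanSpace ℝ (Fin n) =>
      ENNReal.ofReal (1 / ballVol z.1 ^ (1 - a)) :=
    ((((measurable_ballVol hn).comp measurable_fst).pow_const _).const_div 1).ennreal_ofReal
  have h2 : MeasurableSet {z : EuclideanSpace ℝ (Fin n) × EuclideanSpace ℝ (Fin n) |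
      ‖z.2‖ < ‖z.1‖} := measurableSet_lt (by fun_prop) (by fun_prop)
  convert h1.indicator h2 using 1
  ext z
  by_cases hz : ‖z.2‖ < ‖z.1‖ <;> simp [Function.uncurry, hardyKernel, hz]

lemma lintegral_hardyKernel_mul (a : ℝ) (x : EuclideanSpace ℝ (Fin n))
    (g : EuclideanSpace ℝ (Fin n) → ℝ≥0∞) :
    ∫⁻ y, hardyKernel a x y * g y =
      ENNReal.ofReal (1 / ballVol x ^ (1 - a)) * ∫⁻ y in Metric.ball 0 ‖x‖, g y := by
  rw [← lintegral_const_mul' _ _ ENNReal.ofReal_ne_top,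
    ← lintegral_indicator Metric.isOpen_ball.measurableSet]
  refine lintegral_congr fun y => ?_
  by_cases hy : y ∈ Metric.ball 0 ‖x‖
  · simp only [hardyKernel, indicator_of_mem hy]
  · simp only [hardyKernel, indicator_of_notMem hy, zero_mul]

variable {q r a : ℝ}

/-- The inner integral depends on x only through `ballVol x`, so the outer one can be pushed forward
to (0,∞); the weight has exponent -q(1-a) = -(q-r). -/
lemma lintegral_hardyKernel_rpow (hn : 0 < n) (hq : 0 < q) (hra : q * a = r)
    (g : EuclideanSpace ℝ (Fin n) → ℝ≥0∞) :
    ∫⁻ x, (∫⁻ y, hardyKernel a x y * g y) ^ q =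
      ∫⁻ t in Ioi 0, (∫⁻ y in {y | ballVol y < t}, g y) ^ q *
        ENNReal.ofReal (t ^ (-(q - r))) := by
  rw [← map_ballVol hn, lintegral_map _ (measurable_ballVol hn)]
  · refine lintegral_congr fun x => ?_
    rw [lintegral_hardyKernel_mul, setOf_ballVol_lt hn, ENNReal.mul_rpow_of_nonneg _ _ hq.le,
      ENNReal.ofReal_rpow_of_nonneg (by have := ballVol_nonneg x; positivity) hq.le, mul_comm,
      one_div, ← Real.rpow_neg (ballVol_nonneg x), ← Real.rpow_mul (ballVol_nonneg x)]
    congr 3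
    rw [← hra]; ring
  · exact ((monotone_setLIntegral_lt g).measurable.pow_const q).mul
      (Measurable.ennreal_ofReal (measurable_id.pow_const _))

end BallVol

/-! ### The Hardy operator as a tensor product of kernels. -/

section HardyOp

variable {𝕜 : Type*} [RCLike 𝕜] {m : ℕ} {n : Fin m → ℕ} {β : Fin m → ℝ}

lemma measurableSet_polyBall (x : ProdSpace n) : MeasurableSet (polyBall x) :=
  MeasurableSet.univ_pi fun _ => Metric.isOpen_ball.measurableSet

lemma volume_polyBall_lt_top (x : ProdSpace n) : volume (polyBall x) < ∞ := by
  rw [polyBall, volume_pi_pi]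
  exact ENNReal.prod_lt_top fun i _ => measure_ball_lt_top

lemma integrableOn_polyBall {p : ℝ≥0∞} (hp : 1 ≤ p) {f : ProdSpace n → 𝕜} (hf : MemLp f p volume)
    (x : ProdSpace n) : IntegrableOn f (polyBall x) volume := by
  have : IsFiniteMeasure (volume.restrict (polyBall x)) :=
    ⟨by rw [Measure.restrict_apply_univ]; exact volume_polyBall_lt_top x⟩
  exact hf.restrict _ |>.integrable hp

lemma hardyOp_congr {f g : ProdSpace n → 𝕜} (h : f =ᵐ[volume] g) :
    hardyOp β f = hardyOp β g := by
  ext x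
  rw [hardyOp, hardyOp, integral_congr_ae (ae_restrict_of_ae h)]

lemma prod_hardyKernel (x y : ProdSpace n) :
    ∏ i, hardyKernel (β i / n i) (x i) (y i) =
      (polyBall x).indicator (fun _ => ENNReal.ofReal (∏ i, 1 / (volume.real
        (Metric.ball (0 : EuclideanSpace ℝ (Fin (n i))) ‖x i‖)) ^ (1 - β i / (n i : ℝ)))) y := by
  by_cases hy : y ∈ polyBall x
  · rw [indicator_of_mem hy, ENNReal.ofReal_prod_of_nonneg fun i _ => by positivity]
    refine Finset.prod_congr rfl fun i _ => ?_
    rw [hardyKernel, indicator_of_mem (hy i (mem_univ i)), ballVol]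
  · rw [indicator_of_notMem hy]
    obtain ⟨i, hi⟩ : ∃ i, y i ∉ Metric.ball 0 ‖x i‖ := by
      by_contra! h
      exact hy fun i _ => h i
    exact Finset.prod_eq_zero (Finset.mem_univ i) (indicator_of_notMem hi _)

lemma lintegral_prod_hardyKernel_mul (x : ProdSpace n) (g : ProdSpace n → ℝ≥0∞) :
    ∫⁻ y, (∏ i, hardyKernel (β i / n i) (x i) (y i)) * g y =
      ENNReal.ofReal (∏ i, 1 / (volume.real
        (Metric.ball (0 : EuclideanSpace ℝ (Fin (n i))) ‖x i‖)) ^ (1 - β i / (n i : ℝ))) *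
        ∫⁻ y in polyBall x, g y := by
  rw [← lintegral_const_mul' _ _ ENNReal.ofReal_ne_top,
    ← lintegral_indicator (measurableSet_polyBall x)]
  refine lintegral_congr fun y => ?_
  rw [prod_hardyKernel]
  by_cases hy : y ∈ polyBall x
  · simp only [indicator_of_mem hy]
  · simp only [indicator_of_notMem hy, zero_mul]

lemma enorm_hardyOp (f : ProdSpace n → 𝕜) (x : ProdSpace n) :
    ‖hardyOp β f x‖ₑ = ENNReal.ofReal (∏ i, 1 / (volume.real
        (Metric.ball (0 : EuclideanSpace ℝ (Fin (n i))) ‖x i‖)) ^ (1 - β i / (n i : ℝ))) *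
        ‖∫ y in polyBall x, f y‖ₑ := by
  rw [hardyOp, enorm_smul, Real.enorm_of_nonneg (Finset.prod_nonneg fun i _ => by positivity)]

lemma enorm_hardyOp_le (f : ProdSpace n → 𝕜) (x : ProdSpace n) :
    ‖hardyOp β f x‖ₑ ≤ ∫⁻ y, (∏ i, hardyKernel (β i / n i) (x i) (y i)) * ‖f y‖ₑ := by
  rw [enorm_hardyOp, lintegral_prod_hardyKernel_mul]
  gcongr
  exact enorm_integral_le_lintegral_enorm _

/-- Equality in `enorm_hardyOp_le` for non-negative functions, needed for the extremal. -/
lemma enorm_hardyOp_ofReal {f : ProdSpace n → ℝ} (hf : 0 ≤ f) {x : ProdSpace n}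
    (hfi : IntegrableOn f (polyBall x) volume) :
    ‖hardyOp β (fun y => (f y : 𝕜)) x‖ₑ =
      ∫⁻ y, (∏ i, hardyKernel (β i / n i) (x i) (y i)) * ENNReal.ofReal (f y) := by
  rw [enorm_hardyOp, lintegral_prod_hardyKernel_mul, integral_ofReal,
    ← ofReal_integral_eq_lintegral_ofReal hfi (ae_of_all _ hf), ← ofReal_norm, RCLike.norm_ofReal,
    abs_of_nonneg (integral_nonneg hf)]

lemma aestronglyMeasurable_hardyOp (hn : ∀ i, 0 < n i) {f : ProdSpace n → 𝕜}
    (hf : AEStronglyMeasurable f volume) : AEStronglyMeasurable (hardyOp β f) volume := by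
  -- The operator ignores null sets; a strongly measurable representative makes the integrand
  -- jointly measurable.
  rw [hardyOp_congr hf.ae_eq_mk]
  refine AEStronglyMeasurable.smul ?_ ?_
  · refine (Finset.measurable_prod _ fun i _ => ?_).aestronglyMeasurable
    exact (((measurable_ballVol (hn i)).comp (measurable_pi_apply i)).pow_const _).const_div 1
  · have hset : MeasurableSet {z : ProdSpace n × ProdSpace n | z.2 ∈ polyBall z.1} := by
      have : {z : ProdSpace n × ProdSpace n | z.2 ∈ polyBall z.1} =
          ⋂ i, {z | ‖z.2 i‖ < ‖z.1 i‖} := by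
        ext z
        simp [polyBall]
      rw [this]
      exact MeasurableSet.iInter fun i => measurableSet_lt (by fun_prop) (by fun_prop)
    have h1 : StronglyMeasurable (Function.uncurry fun x y : ProdSpace n =>
        (polyBall x).indicator (hf.mk f) y) := by
      convert (hf.stronglyMeasurable_mk.comp_measurable
        (measurable_snd (α := ProdSpace n) (β := ProdSpace n))).indicator hset using 1
      ext z
      by_cases hz : z.2 ∈ polyBall z.1 <;> simp [Function.uncurry, hz]
    refine (StronglyMeasurable.integral_prod_right (ν := volume) h1).aestronglyMeasurable.congr ?_
    exact ae_of_all _ fun x => integral_indicator (measurableSet_polyBall x)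

end HardyOp

/-! ### The sharp constant and its attainment. -/

section HardyNorm

variable {𝕜 : Type*} [RCLike 𝕜] {m : ℕ} {n : Fin m → ℕ} {β : Fin m → ℝ} {p q r : ℝ}

/-- The best constant in Bliss' inequality. -/
noncomputable def blissConst (q r : ℝ) : ℝ :=
  (1 / (q - r - 1)) ^ (1 / q) * blissMass q r ^ (-(r / q))

lemma blissConst_nonneg (hr : 0 < r) (hq : r + 1 < q) : 0 ≤ blissConst q r := by
  have := blissMass_pos hr hq
  have : 0 < q - r - 1 := by linarith
  unfold blissConst
  positivity

lemma blissConst_rpow (hr : 0 < r) (hq : r + 1 < q) :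
    blissConst q r ^ q = blissMass q r ^ (-r) / (q - r - 1) := by
  have hI := blissMass_pos hr hq
  have hq1 : 0 < q - r - 1 := by linarith
  have hq0 : 0 < q := by linarith
  rw [blissConst, Real.mul_rpow (by positivity) (by positivity), ← Real.rpow_mul (by positivity),
    ← Real.rpow_mul hI.le, one_div_mul_cancel hq0.ne', Real.rpow_one, neg_mul,
    div_mul_cancel₀ _ hq0.ne']
  ring

/-- The equality case on one factor, read as constant times L^p norm equals L^q norm. -/
lemma blissConst_mul (hr : 0 < r) (hq : r + 1 < q) :
    blissConst q r * blissMass q r ^ ((r + 1) / q) = (blissMass q r / (q - r - 1)) ^ (1 / q) := by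
  have hI := blissMass_pos hr hq
  have hq1 : 0 < q - r - 1 := by linarith
  rw [blissConst, mul_assoc, ← Real.rpow_add hI, div_eq_mul_one_div (blissMass q r),
    Real.mul_rpow hI.le (by positivity), mul_comm]
  congr 2
  ring

/-- All factors coincide: n_i/(qβ_i) = 1/r, n_i/(q'β_i) = (q-1)/r and p'/q = 1/(q-r-1), so the Beta
value is `blissMass`. -/
lemma hardyConst_eq_pow (hp : 0 < p) (hpq : p < q) (hβ : ∀ i, 0 < β i ∧ β i < (n i : ℝ))
    (hβr : ∀ i, q * (β i / n i) = r) (hqr : q / p = r + 1) (hq : r + 1 < q) :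
    hardyConst n β p q = blissConst q r ^ m := by
  have hq0 : 0 < q := hp.trans hpq
  have hr : 0 < r := by
    have : 1 < q / p := (one_lt_div hp).2 hpq
    linarith
  have hpe : p = q / (r + 1) := by rw [← hqr]; field_simp
  rw [hardyConst, ← Fin.prod_const]
  refine Finset.prod_congr rfl fun i _ => ?_
  have hn : 0 < (n i : ℝ) := (hβ i).1.trans (hβ i).2
  have hβ0 := (hβ i).1
  have h1 : (n i : ℝ) / (q * β i) = 1 / r := by rw [← hβr i]; field_simp
  have h2 : (n i : ℝ) / (q.conjExponent * β i) = (q - 1) / r := by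
    rw [← hβr i, Real.conjExponent]
    have : q - 1 ≠ 0 := by linarith
    field_simp
  have h3 : p.conjExponent / q = 1 / (q - r - 1) := by
    have h4 : q - r - 1 ≠ 0 := by linarith
    have h5 : p - 1 = (q - r - 1) / (r + 1) := by rw [hpe]; field_simp; ring
    rw [Real.conjExponent, h5, hpe]
    field_simp
  have h4 : β i / n i = r / q := by rw [← hβr i]; field_simp
  rw [h1, h2, h3, h4, ← blissMass_eq_eulerBeta hr, blissConst]

lemma eLpNorm_ofReal_eq {X : Type*} [MeasurableSpace X] {μ : Measure X} {s : ℝ} (hs : 0 < s)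
    (f : X → 𝕜) :
    eLpNorm f (ENNReal.ofReal s) μ = (∫⁻ x, ‖f x‖ₑ ^ s ∂μ) ^ (1 / s) := by
  rw [eLpNorm_eq_lintegral_rpow_enorm_toReal (by simpa using hs) ENNReal.ofReal_ne_top,
    ENNReal.toReal_ofReal hs.le]

lemma eLpNorm_hardyOp_le (hr : 0 < r) (hq : r + 1 < q) (hn : ∀ i, 0 < n i)
    (hβr : ∀ i, q * (β i / n i) = r) {f : ProdSpace n → 𝕜} (hf : AEStronglyMeasurable f volume) :
    eLpNorm (hardyOp β f) (ENNReal.ofReal q) volume ≤ ENNReal.ofReal (blissConst q r ^ m) *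
      eLpNorm f (ENNReal.ofReal (q / (r + 1))) volume := by
  have hq0 : 0 < q := by linarith
  have hc := blissConst_nonneg hr hq
  rw [hardyOp_congr hf.ae_eq_mk, eLpNorm_congr_ae hf.ae_eq_mk, eLpNorm_ofReal_eq hq0,
    eLpNorm_ofReal_eq (by positivity)]
  have key := lintegral_prod_kernel_le (fun _ => volume) (fun i => hardyKernel (β i / n i))
    (fun i => measurable_hardyKernel (hn i) _) (p := q / (r + 1)) (q := q) (by positivity)
    (div_le_self hq0.le (by linarith))
    (fun _ => ENNReal.ofReal (blissMass q r ^ (-r) / (q - r - 1)))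
    (fun i g hg => by
      rw [lintegral_hardyKernel_rpow (hn i) hq0 (hβr i), div_div_cancel₀ hq0.ne']
      exact bliss_lintegral_le (measurable_ballVol (hn i)) (map_ballVol (hn i)) hr hq hg)
    (fun y => ‖hf.mk f y‖ₑ) hf.stronglyMeasurable_mk.enorm
  rw [div_div_cancel₀ hq0.ne', ← blissConst_rpow hr hq, Fin.prod_const,
    ← ENNReal.ofReal_rpow_of_nonneg hc hq0.le] at key
  calc (∫⁻ x, ‖hardyOp β (hf.mk f) x‖ₑ ^ q) ^ (1 / q)
      ≤ ((ENNReal.ofReal (blissConst q r) ^ q) ^ m *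
          (∫⁻ y, ‖hf.mk f y‖ₑ ^ (q / (r + 1))) ^ (r + 1)) ^ (1 / q) := by
        refine ENNReal.rpow_le_rpow (le_trans ?_ key) (by positivity)
        exact lintegral_mono fun x => ENNReal.rpow_le_rpow (enorm_hardyOp_le _ x) hq0.le
    _ = _ := by
        rw [ENNReal.mul_rpow_of_nonneg _ _ (by positivity), ← ENNReal.rpow_mul,
          ← ENNReal.rpow_natCast, ← ENNReal.rpow_mul, ← ENNReal.rpow_mul,
          ENNReal.ofReal_pow hc, ← ENNReal.rpow_natCast]
        congr 2
        · field_simp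
        · field_simp

/-- The tensor product of the extremal functions of Bliss' inequality. -/
noncomputable def hardyExtremal (r : ℝ) (y : ProdSpace n) : ℝ :=
  ∏ i, blissExtremal r (ballVol (y i))

lemma hardyExtremal_nonneg (r : ℝ) : 0 ≤ (hardyExtremal r : ProdSpace n → ℝ) :=
  fun y => Finset.prod_nonneg fun i _ => blissExtremal_nonneg (ballVol_nonneg (y i)) r

lemma ofReal_hardyExtremal (r : ℝ) (y : ProdSpace n) :
    ENNReal.ofReal (hardyExtremal r y) = ∏ i, ENNReal.ofReal (blissExtremal r (ballVol (y i))) :=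
  ENNReal.ofReal_prod_of_nonneg fun i _ => blissExtremal_nonneg (ballVol_nonneg (y i)) r

lemma measurable_hardyExtremal (hn : ∀ i, 0 < n i) :
    Measurable (hardyExtremal r : ProdSpace n → ℝ) :=
  Finset.measurable_prod _ fun i _ =>
    (measurable_blissExtremal r).comp ((measurable_ballVol (hn i)).comp (measurable_pi_apply i))

lemma enorm_ofReal_of_nonneg {t : ℝ} (ht : 0 ≤ t) : ‖(t : 𝕜)‖ₑ = ENNReal.ofReal t := by
  rw [← ofReal_norm, RCLike.norm_ofReal, abs_of_nonneg ht]

lemma eLpNorm_hardyExtremal (hr : 0 < r) (hq : r + 1 < q) (hn : ∀ i, 0 < n i) :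
    eLpNorm (fun y : ProdSpace n => (hardyExtremal r y : 𝕜)) (ENNReal.ofReal (q / (r + 1))) volume =
      ENNReal.ofReal (blissMass q r ^ ((r + 1) / q)) ^ m := by
  have hq0 : 0 < q := by linarith
  have hI := blissMass_pos hr hq
  have hp0 : 0 < q / (r + 1) := by positivity
  rw [eLpNorm_ofReal_eq hp0]
  simp_rw [fun y : ProdSpace n => enorm_ofReal_of_nonneg (𝕜 := 𝕜) (hardyExtremal_nonneg r y),
    ofReal_hardyExtremal, ← ENNReal.prod_rpow_of_nonneg hp0.le]
  rw [volume_pi, lintegral_pi_prod_eq (fun _ => volume)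
    (fun i y => ENNReal.ofReal (blissExtremal r (ballVol y)) ^ (q / (r + 1)))
    (fun i => (((measurable_blissExtremal r).comp
      (measurable_ballVol (hn i))).ennreal_ofReal.pow_const _))]
  simp_rw [fun i => lintegral_blissExtremal_rpow (measurable_ballVol (hn i)) (map_ballVol (hn i))
    hr hq]
  rw [Fin.prod_const, ← ENNReal.ofReal_rpow_of_pos hI, ← ENNReal.rpow_natCast,
    ← ENNReal.rpow_natCast, ← ENNReal.rpow_mul, ← ENNReal.rpow_mul, one_div_div, mul_comm]

lemma memLp_hardyExtremal (hr : 0 < r) (hq : r + 1 < q) (hn : ∀ i, 0 < n i) :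
    MemLp (fun y : ProdSpace n => (hardyExtremal r y : 𝕜)) (ENNReal.ofReal (q / (r + 1)))
      volume := by
  refine ⟨(RCLike.measurable_ofReal.comp (measurable_hardyExtremal hn)).aestronglyMeasurable, ?_⟩
  rw [eLpNorm_hardyExtremal hr hq hn]
  finiteness

lemma eLpNorm_hardyExtremal_ne_zero (hr : 0 < r) (hq : r + 1 < q) (hn : ∀ i, 0 < n i) :
    eLpNorm (fun y : ProdSpace n => (hardyExtremal r y : 𝕜)) (ENNReal.ofReal (q / (r + 1)))
      volume ≠ 0 := by
  rw [eLpNorm_hardyExtremal hr hq hn]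
  have := Real.rpow_pos_of_pos (blissMass_pos hr hq) ((r + 1) / q)
  exact pow_ne_zero _ (by simpa using this)

/-- On a product of functions of one coordinate both norms factor, and each factor is an equality
case of Bliss' inequality. -/
lemma eLpNorm_hardyOp_hardyExtremal (hr : 0 < r) (hq : r + 1 < q) (hn : ∀ i, 0 < n i)
    (hβr : ∀ i, q * (β i / n i) = r) :
    eLpNorm (hardyOp β fun y : ProdSpace n => (hardyExtremal r y : 𝕜)) (ENNReal.ofReal q) volume =
      ENNReal.ofReal (blissConst q r ^ m) * eLpNorm (fun y : ProdSpace n =>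
        (hardyExtremal r y : 𝕜)) (ENNReal.ofReal (q / (r + 1))) volume := by
  have hq0 : 0 < q := by linarith
  have hq1 : 0 < q - r - 1 := by linarith
  have hI := blissMass_pos hr hq
  have hp1 : 1 ≤ ENNReal.ofReal (q / (r + 1)) := by
    rw [ENNReal.one_le_ofReal, one_le_div (by linarith)]; exact hq.le
  have hint := integrableOn_polyBall hp1 (memLp_hardyExtremal (𝕜 := ℝ) hr hq hn)
  have hx : ∀ x : ProdSpace n, ‖hardyOp β (fun y : ProdSpace n => (hardyExtremal r y : 𝕜)) x‖ₑ =
      ∏ i, ∫⁻ y, hardyKernel (β i / n i) (x i) y * ENNReal.ofReal (blissExtremal r (ballVol y)) := by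
    intro x
    rw [enorm_hardyOp_ofReal (hardyExtremal_nonneg r) (hint x)]
    simp_rw [ofReal_hardyExtremal, ← Finset.prod_mul_distrib]
    exact lintegral_pi_prod_eq (fun _ => volume) _ fun i =>
      (measurable_hardyKernel (hn i) _).of_uncurry_left.mul
        ((measurable_blissExtremal r).comp (measurable_ballVol (hn i))).ennreal_ofReal
  rw [eLpNorm_ofReal_eq hq0, eLpNorm_hardyExtremal hr hq hn]
  simp_rw [hx, ← ENNReal.prod_rpow_of_nonneg hq0.le]
  rw [volume_pi, lintegral_pi_prod_eq (fun _ => volume) (fun i x =>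
    (∫⁻ y, hardyKernel (β i / n i) x y * ENNReal.ofReal (blissExtremal r (ballVol y))) ^ q)]
  · simp_rw [fun i => lintegral_hardyKernel_rpow (hn i) hq0 (hβr i),
      fun i => bliss_lintegral_extremal (measurable_ballVol (hn i)) (map_ballVol (hn i)) hr hq]
    rw [Fin.prod_const, ENNReal.ofReal_pow (blissConst_nonneg hr hq), ← mul_pow,
      ← ENNReal.ofReal_mul (blissConst_nonneg hr hq), blissConst_mul hr hq,
      ← ENNReal.ofReal_rpow_of_pos (by positivity), ← ENNReal.rpow_natCast, ← ENNReal.rpow_natCast,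
      ← ENNReal.rpow_mul, ← ENNReal.rpow_mul, mul_comm]
  · intro i
    refine Measurable.pow_const (Measurable.lintegral_prod_right (f := fun x y =>
      hardyKernel (β i / n i) x y * ENNReal.ofReal (blissExtremal r (ballVol y))) ?_) _
    exact (measurable_hardyKernel (hn i) _).mul
      (((measurable_blissExtremal r).comp (measurable_ballVol (hn i))).ennreal_ofReal.comp
        measurable_snd)

lemma hardyOp_add {f g : ProdSpace n → 𝕜} (hf : ∀ x, IntegrableOn f (polyBall x) volume)
    (hg : ∀ x, IntegrableOn g (polyBall x) volume) :
    hardyOp β (f + g) = hardyOp β f + hardyOp β g := by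
  ext x
  simp only [hardyOp, Pi.add_apply]
  rw [integral_add (hf x) (hg x), smul_add]

lemma hardyOp_const_smul (c : 𝕜) (f : ProdSpace n → 𝕜) :
    hardyOp β (c • f) = c • hardyOp β f := by
  ext x
  simp only [hardyOp, Pi.smul_apply]
  rw [integral_smul, smul_comm]

lemma memLp_hardyOp (hr : 0 < r) (hq : r + 1 < q) (hn : ∀ i, 0 < n i)
    (hβr : ∀ i, q * (β i / n i) = r) {f : ProdSpace n → 𝕜}
    (hf : MemLp f (ENNReal.ofReal (q / (r + 1))) volume) :
    MemLp (hardyOp β f) (ENNReal.ofReal q) volume :=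
  ⟨aestronglyMeasurable_hardyOp hn hf.1, (eLpNorm_hardyOp_le hr hq hn hβr hf.1).trans_lt
    (ENNReal.mul_lt_top ENNReal.ofReal_lt_top hf.2)⟩

/-- The fractional Hardy operator as a bounded operator from `L^p` to `L^q`. -/
lemma exists_hardyOp_clm [Fact (1 ≤ ENNReal.ofReal (q / (r + 1)))] [Fact (1 ≤ ENNReal.ofReal q)]
    (hr : 0 < r) (hq : r + 1 < q) (hn : ∀ i, 0 < n i) (hβr : ∀ i, q * (β i / n i) = r) :
    ∃ T : Lp 𝕜 (ENNReal.ofReal (q / (r + 1))) (volume : Measure (ProdSpace n)) →L[𝕜]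
        Lp 𝕜 (ENNReal.ofReal q) (volume : Measure (ProdSpace n)),
      (∀ f, (T f : ProdSpace n → 𝕜) =ᵐ[volume] hardyOp β (f : ProdSpace n → 𝕜)) ∧
      ‖T‖ = blissConst q r ^ m := by
  have hc : 0 ≤ blissConst q r ^ m := pow_nonneg (blissConst_nonneg hr hq) m
  have hmem : ∀ f : Lp 𝕜 (ENNReal.ofReal (q / (r + 1))) (volume : Measure (ProdSpace n)),
      MemLp (hardyOp β (f : ProdSpace n → 𝕜)) (ENNReal.ofReal q) volume := fun f =>
    memLp_hardyOp hr hq hn hβr (Lp.memLp f)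
  have hint : ∀ f : Lp 𝕜 (ENNReal.ofReal (q / (r + 1))) (volume : Measure (ProdSpace n)),
      ∀ x, IntegrableOn (f : ProdSpace n → 𝕜) (polyBall x) volume := fun f =>
    integrableOn_polyBall Fact.out (Lp.memLp f)
  let L : Lp 𝕜 (ENNReal.ofReal (q / (r + 1))) (volume : Measure (ProdSpace n)) →ₗ[𝕜]
      Lp 𝕜 (ENNReal.ofReal q) (volume : Measure (ProdSpace n)) :=
    { toFun := fun f => (hmem f).toLp _
      map_add' := fun f g => by
        rw [← MemLp.toLp_add, MemLp.toLp_eq_toLp_iff, hardyOp_congr (Lp.coeFn_add f g),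
          hardyOp_add (hint f) (hint g)]
      map_smul' := fun c f => by
        rw [RingHom.id_apply, ← MemLp.toLp_const_smul, MemLp.toLp_eq_toLp_iff,
          hardyOp_congr (Lp.coeFn_smul c f), hardyOp_const_smul] }
  have hL : ∀ f, ‖L f‖ ≤ blissConst q r ^ m * ‖f‖ := fun f => by
    change ‖(hmem f).toLp _‖ ≤ _
    rw [Lp.norm_toLp, Lp.norm_def, ← ENNReal.toReal_ofReal hc, ← ENNReal.toReal_mul]
    refine ENNReal.toReal_mono (ENNReal.mul_ne_top (by simp) (Lp.eLpNorm_ne_top f)) ?_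
    exact eLpNorm_hardyOp_le hr hq hn hβr (Lp.aestronglyMeasurable f)
  refine ⟨L.mkContinuous _ hL, fun f => (hmem f).coeFn_toLp,
    le_antisymm (L.mkContinuous_norm_le hc hL) ?_⟩
  -- The lower bound for the norm: the extremal has non-zero norm and attains the constant.
  have hE := memLp_hardyExtremal (𝕜 := 𝕜) hr hq hn
  have hE0 : 0 < ‖hE.toLp _‖ := by
    rw [Lp.norm_toLp]
    exact ENNReal.toReal_pos (eLpNorm_hardyExtremal_ne_zero hr hq hn) hE.2.ne
  have h1 : ‖L.mkContinuous _ hL (hE.toLp _)‖ = blissConst q r ^ m * ‖hE.toLp _‖ := by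
    change ‖(hmem (hE.toLp _)).toLp _‖ = _
    rw [Lp.norm_toLp, hardyOp_congr hE.coeFn_toLp, eLpNorm_hardyOp_hardyExtremal hr hq hn hβr,
      Lp.norm_toLp, ENNReal.toReal_mul, ENNReal.toReal_ofReal hc]
  have h2 := (L.mkContinuous _ hL).le_opNorm (hE.toLp _)
  rw [h1] at h2
  exact le_of_mul_le_mul_right h2 hE0

end HardyNorm

end

/-! ### The sharp bound. -/

theorem theorem1 (𝕜 : Type*) [RCLike 𝕜] (m : ℕ) (n : Fin m → ℕ) (β : Fin m → ℝ) (p q : ℝ)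
    (hp : 1 < p) (hpq : p < q)
    (hβ : ∀ i, 0 < β i ∧ β i < (n i : ℝ))
    (hscale : ∀ i, 1 / q = 1 / p - β i / (n i : ℝ)) :
    -- the operator is well defined on `L^p`, maps it to `L^q`, and has bound `C`
    (∀ f : ProdSpace n → 𝕜, MemLp f (ENNReal.ofReal p) volume →
      (∀ x : ProdSpace n, IntegrableOn f (polyBall x) volume) ∧
      MemLp (hardyOp β f) (ENNReal.ofReal q) volume ∧
      eLpNorm (hardyOp β f) (ENNReal.ofReal q) volume ≤
        ENNReal.ofReal (hardyConst n β p q) * eLpNorm f (ENNReal.ofReal p) volume) ∧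
    -- as a bounded linear operator from `L^p` to `L^q` its operator norm is `C`
    (∃ (_ : Fact (1 ≤ ENNReal.ofReal p)) (_ : Fact (1 ≤ ENNReal.ofReal q))
      (T : Lp 𝕜 (ENNReal.ofReal p) (volume : Measure (ProdSpace n)) →L[𝕜]
        Lp 𝕜 (ENNReal.ofReal q) (volume : Measure (ProdSpace n))),
      (∀ f : Lp 𝕜 (ENNReal.ofReal p) (volume : Measure (ProdSpace n)),
        (T f : ProdSpace n → 𝕜) =ᵐ[volume] hardyOp β (f : ProdSpace n → 𝕜)) ∧
      ‖T‖ = hardyConst n β p q) ∧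
    -- on the non-negative functions of `L^p` the supremum of the quotients is `C` as well
    (⨆ (f : ProdSpace n → ℝ) (_ : 0 ≤ f) (_ : MemLp f (ENNReal.ofReal p) volume)
        (_ : eLpNorm f (ENNReal.ofReal p) volume ≠ 0),
        eLpNorm (hardyOp β f) (ENNReal.ofReal q) volume /
          eLpNorm f (ENNReal.ofReal p) volume) =
      ENNReal.ofReal (hardyConst n β p q) := by
  have hp0 : 0 < p := by linarith
  have hq0 : 0 < q := by linarith
  have hn : ∀ i, 0 < n i := fun i => by
    have h : (0 : ℝ) < n i := (hβ i).1.trans (hβ i).2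
    exact_mod_cast h
  -- r is defined from p and q alone, so the argument also covers m = 0; the scaling relation gives
  -- r = qβ_i/n_i for every i.
  obtain ⟨r, hqr⟩ : ∃ r, q / p = r + 1 := ⟨q / p - 1, by ring⟩
  have hr : 0 < r := by
    have : 1 < q / p := (one_lt_div hp0).2 hpq
    linarith
  have hq : r + 1 < q := by
    rw [← hqr]
    exact div_lt_self hq0 hp
  have hβr : ∀ i, q * (β i / n i) = r := fun i => by
    have h1 : β i / n i = 1 / p - 1 / q := by linarith [hscale i]
    rw [h1, mul_sub, mul_one_div_cancel hq0.ne', mul_one_div, hqr]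
    ring
  rw [hardyConst_eq_pow hp0 hpq hβ hβr hqr hq]
  obtain rfl : p = q / (r + 1) := by rw [← hqr, div_div_cancel₀ hq0.ne']
  have hp1 : 1 ≤ ENNReal.ofReal (q / (r + 1)) := ENNReal.one_le_ofReal.2 hp.le
  have hq1 : 1 ≤ ENNReal.ofReal q := ENNReal.one_le_ofReal.2 (hp.trans hpq).le
  refine ⟨fun f hf => ⟨integrableOn_polyBall hp1 hf, memLp_hardyOp hr hq hn hβr hf,
    eLpNorm_hardyOp_le hr hq hn hβr hf.1⟩, ?_, le_antisymm ?_ ?_⟩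
  · have : Fact (1 ≤ ENNReal.ofReal (q / (r + 1))) := ⟨hp1⟩
    have : Fact (1 ≤ ENNReal.ofReal q) := ⟨hq1⟩
    exact ⟨inferInstance, inferInstance, exists_hardyOp_clm hr hq hn hβr⟩
  · refine iSup_le fun f => iSup_le fun _ => iSup_le fun hf => iSup_le fun _ => ?_
    exact ENNReal.div_le_of_le_mul (eLpNorm_hardyOp_le hr hq hn hβr hf.1)
  · have hE : MemLp (hardyExtremal r : ProdSpace n → ℝ) _ volume :=
      memLp_hardyExtremal (𝕜 := ℝ) hr hq hn
    have hE0 : eLpNorm (hardyExtremal r : ProdSpace n → ℝ) _ volume ≠ 0 :=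
      eLpNorm_hardyExtremal_ne_zero (𝕜 := ℝ) hr hq hn
    have heq : eLpNorm (hardyOp β (hardyExtremal r : ProdSpace n → ℝ)) _ volume = _ :=
      eLpNorm_hardyOp_hardyExtremal (𝕜 := ℝ) hr hq hn hβr
    refine le_iSup_of_le (hardyExtremal r) (le_iSup_of_le (hardyExtremal_nonneg r)
      (le_iSup_of_le hE (le_iSup_of_le hE0 ?_)))
    rw [heq]
    exact (ENNReal.mul_div_cancel_right hE0 hE.2.ne).ge
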